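/- Conventions. $X=(X,d_X,\mu)$ and $Y=(Y,d_Y,\nu)$ are separable metric spaces with Borel measures that are locally finite (every point has a neighbourhood of finite measure) and positive on nonempty open sets. A curve is a continuous map $\gamma\colon[a,b]\to X$ on a compact interval; it is rectifiable if its length $\ell(\gamma)$ is finite, and then $\int_\gamma\rho\,ds=\int_0^{\ell(\gamma)}\rho(\gamma_s(t))\,dt$ for Borel $\rho\colon X\to[0,\infty]$, where $\gamma_s$ is the arc-length parametrization of $\gamma$. For $Q>1$ the $Q$-modulus of a family $\Gamma$ of curves in $X$ is $\mathrm{Mod}_Q(\Gamma)=\inf_\rho\int_X\rho^Q\,d\mu\in[0,\infty]$, the infimum being over all Borel $\rho\colon X\to[0,\infty]$ with $\int_\gamma\rho\,ds\ge 1$ for every rectifiable $\gamma\in\Gamma$ ($\inf\emptyset=\infty$); similarly in $Y$ with $\nu$. A Borel function $g\colon X\to[0,\infty]$ is an upper gradient of $f\colon X\to Y$ if $d_Y(f(\gamma(a)),f(\gamma(b)))\le\int_\gamma g\,ds$ for every rectifiable curve $\gamma\colon[a,b]\to X$, and a $Q$-weak upper gradient if the rectifiable curves for which this fails form a family of $Q$-modulus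 $0$. A Borel $g\colon X\to[0,\infty]$ is in $L^Q_{\mathrm{loc}}(X)$ if every point of $X$ has an open neighbourhood $U$ with $\int_U g^Q\,d\mu<\infty$; a Borel map $f\colon X\to Y$ is in $L^Q_{\mathrm{loc}}(X,Y)$ if every point of $X$ has an open neighbourhood $U$ with $\int_U d_Y(z,f(x))^Q\,d\mu(x)<\infty$ for some $z\in Y$; and $f\in N^{1,Q}_{\mathrm{loc}}(X,Y)$ if $f\in L^Q_{\mathrm{loc}}(X,Y)$ and $f$ has an upper gradient in $L^Q_{\mathrm{loc}}(X)$. A minimal $Q$-weak upper gradient of $f$ is a $Q$-weak upper gradient $g_f\in L^Q_{\mathrm{loc}}(X)$ of $f$ such that $g_f\le g$ $\mu$-a.e. for every $Q$-weak upper gradient $g\in L^Q_{\mathrm{loc}}(X)$ of $f$; it is unique up to sets of $\mu$-measure $0$. For a homeomorphism $f$, the volume derivative $J_f$ is the Radon–Nikodym derivative with respect to $\mu$ of (the absolutely continuous part of) the measure $A\mapsto\nu(f(A))$ on $X$. Theorem. Let $Q>1$, let $X$ and $Y$ be as above, let $f\colon X\to Y$ be a homeomorphism, and let $0<K<\infty$.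 Then the following two conditions are equivalent (with the same constant $K$). (I) $f\in N^{1,Q}_{\mathrm{loc}}(X,Y)$, and $f$ has a minimal $Q$-weak upper gradient $g_f$ with $$g_f(x)^Q\le K\,J_f(x)\qquad\text{for }\mu\text{-almost every }x\in X.$$ (II) For every family $\Gamma$ of curves in $X$, with $f(\Gamma)=\{f\circ\gamma:\gamma\in\Gamma\}$, $$\mathrm{Mod}_Q(\Gamma)\le K\,\mathrm{Mod}_Q(f(\Gamma)).$$ -/

import Mathlib

open Set Filter Topology MeasureTheory
open scoped ENNReal NNReal

noncomputable section

namespace QCMetric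

/-- A (compact, parametrized) curve in `X`: a continuous map from a closed interval `[a, b]`
to `X`. -/
structure Curve (X : Type*) [TopologicalSpace X] where
  a : ℝ
  b : ℝ
  le : a ≤ b
  toMap : C(Icc a b, X)

namespace Curve

/-- The initial point `γ(a)`. -/
def source {X : Type*} [TopologicalSpace X] (γ : Curve X) : X :=
  γ.toMap ⟨γ.a, left_mem_Icc.2 γ.le⟩

/-- The end point `γ(b)`. -/
def target {X : Type*} [TopologicalSpace X] (γ : Curve X) : X :=
  γ.toMap ⟨γ.b, right_mem_Icc.2 γ.le⟩

/-- The image curve `f ∘ γ`. -/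
def map {X Y : Type*} [TopologicalSpace X] [TopologicalSpace Y] (f : C(X, Y)) (γ : Curve X) :
    Curve Y where
  a := γ.a
  b := γ.b
  le := γ.le
  toMap := f.comp γ.toMap

/-- `γ` as a function on `ℝ`, constant on each side of `[a, b]`; only its values on `[a, b]`
are ever used. -/
def extend {X : Type*} [TopologicalSpace X] (γ : Curve X) : ℝ → X :=
  IccExtend γ.le γ.toMap

/-- The length of `γ`, i.e. its total variation on `[a, b]`. -/
def length {X : Type*} [MetricSpace X] (γ : Curve X) : ℝ≥0∞ :=
  eVariationOn γ.extend (Icc γ.a γ.b)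

/-- A curve is rectifiable if its length is finite. -/
def Rectifiable {X : Type*} [MetricSpace X] (γ : Curve X) : Prop :=
  γ.length < ∞

/-- The arc-length parametrization of a rectifiable curve `γ`: on `[0, length γ]` it is
determined by `arcParam γ (v t) = γ t`, where `v t` is the variation of `γ` on `[a, t]`. -/
def arcParam {X : Type*} [MetricSpace X] (γ : Curve X) : ℝ → X :=
  naturalParameterization γ.extend (Icc γ.a γ.b) γ.a

/-- The integral `∫_γ ρ ds` of `ρ : X → [0, ∞]` along a rectifiable curve `γ`. -/
def lineIntegral {X : Type*} [MetricSpace X] (ρ : X → ℝ≥0∞) (γ : Curve X) : ℝ≥0∞ :=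
  ∫⁻ t in Icc (0 : ℝ) γ.length.toReal, ρ (γ.arcParam t)

end Curve

/-- `ρ : X → [0, ∞]` is admissible for the curve family `Γ`: it is Borel, and `∫_γ ρ ds ≥ 1`
for every rectifiable `γ ∈ Γ`. -/
def Admissible {X : Type*} [MetricSpace X] [MeasurableSpace X]
    (ρ : X → ℝ≥0∞) (Γ : Set (Curve X)) : Prop :=
  Measurable ρ ∧ ∀ γ ∈ Γ, γ.Rectifiable → 1 ≤ γ.lineIntegral ρ

/-- The `p`-modulus of a curve family `Γ`; it is `∞` if there is no admissible function. -/
def modulus {X : Type*} [MetricSpace X] [MeasurableSpace X]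
    (p : ℝ) (μ : Measure X) (Γ : Set (Curve X)) : ℝ≥0∞ :=
  ⨅ (ρ : X → ℝ≥0∞) (_ : Admissible ρ Γ), ∫⁻ x, ρ x ^ p ∂μ

/-- `g : X → [0, ∞]` is an upper gradient of `φ : X → Z`. -/
def IsUpperGradient {X Z : Type*} [MetricSpace X] [MeasurableSpace X] [MetricSpace Z]
    (g : X → ℝ≥0∞) (φ : X → Z) : Prop :=
  Measurable g ∧
    ∀ γ : Curve X, γ.Rectifiable → edist (φ γ.source) (φ γ.target) ≤ γ.lineIntegral g

/-- `g : X → [0, ∞]` is a `p`-weak upper gradient of `φ : X → Z`: the family of rectifiable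
curves on which the upper gradient inequality fails has `p`-modulus zero. -/
def IsWeakUpperGradient {X Z : Type*} [MetricSpace X] [MeasurableSpace X] [MetricSpace Z]
    (p : ℝ) (μ : Measure X) (g : X → ℝ≥0∞) (φ : X → Z) : Prop :=
  Measurable g ∧
    modulus p μ {γ : Curve X | γ.Rectifiable ∧
      ¬ edist (φ γ.source) (φ γ.target) ≤ γ.lineIntegral g} = 0

/-- The integrability condition in `L^p_loc(X)`: every point has an open neighbourhood on which
`g ^ p` has finite integral. (Measurability of `g` is demanded wherever this is used.) -/
def LocIntegrablePow {X : Type*} [MetricSpace X] [MeasurableSpace X]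
    (p : ℝ) (μ : Measure X) (g : X → ℝ≥0∞) : Prop :=
  ∀ x : X, ∃ U : Set X, IsOpen U ∧ x ∈ U ∧ ∫⁻ y in U, g y ^ p ∂μ < ∞

/-- `φ ∈ L^p_loc(X, Z)`: `φ` is Borel and, near every point, the distance of `φ` to some point
of `Z` is `p`-integrable. -/
def MemLpLoc {X Z : Type*} [MetricSpace X] [MeasurableSpace X] [MetricSpace Z]
    [MeasurableSpace Z] (p : ℝ) (μ : Measure X) (φ : X → Z) : Prop :=
  Measurable φ ∧
    ∀ x : X, ∃ z : Z, ∃ U : Set X, IsOpen U ∧ x ∈ U ∧ ∫⁻ y in U, edist z (φ y) ^ p ∂μ < ∞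

/-- The local Newton-Sobolev class `N^{1,p}_loc(X, Z)`: maps in `L^p_loc(X, Z)` with an upper
gradient in `L^p_loc(X)`. -/
def MemNewtonLoc {X Z : Type*} [MetricSpace X] [MeasurableSpace X] [MetricSpace Z]
    [MeasurableSpace Z] (p : ℝ) (μ : Measure X) (φ : X → Z) : Prop :=
  MemLpLoc p μ φ ∧
    ∃ g : X → ℝ≥0∞, IsUpperGradient g φ ∧ LocIntegrablePow p μ g

/-- `g` is a minimal `p`-weak upper gradient of `φ`: it is a `p`-weak upper gradient in
`L^p_loc(X)` and lies almost everywhere below every other such one. (Two minimal ones agree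
almost everywhere. The competitors have to be taken in `L^p_loc(X)`: on `[0, 1]` the function
that is `∞` off a nowhere dense closed set `C` and `0` on `C` is an upper gradient of every
map.) -/
def IsMinimalWeakUpperGradient {X Z : Type*} [MetricSpace X] [MeasurableSpace X] [MetricSpace Z]
    (p : ℝ) (μ : Measure X) (g : X → ℝ≥0∞) (φ : X → Z) : Prop :=
  IsWeakUpperGradient p μ g φ ∧ LocIntegrablePow p μ g ∧
    ∀ g' : X → ℝ≥0∞, IsWeakUpperGradient p μ g' φ → LocIntegrablePow p μ g' →
      ∀ᵐ x ∂μ, g x ≤ g' x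

/-- The volume derivative `J_f`: the Radon-Nikodym derivative with respect to `μ` of (the
absolutely continuous part of) the pulled back measure `A ↦ ν (f '' A)`. -/
def volumeDerivative {X Y : Type*} [MetricSpace X] [MeasurableSpace X] [MetricSpace Y]
    [MeasurableSpace Y] (μ : Measure X) (ν : Measure Y) (f : X ≃ₜ Y) : X → ℝ≥0∞ :=
  (ν.map f.symm).rnDeriv μ

/-- The analytic condition: `f ∈ N^{1,Q}_loc(X, Y)`, and the minimal `Q`-weak upper gradient
`g_f` exists and satisfies `g_f ^ Q ≤ K J_f` almost everywhere. -/
def AnalyticCondition {X Y : Type*} [MetricSpace X] [MeasurableSpace X] [MetricSpace Y]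
    [MeasurableSpace Y] (Q : ℝ) (K : ℝ≥0) (μ : Measure X) (ν : Measure Y) (f : X ≃ₜ Y) : Prop :=
  MemNewtonLoc Q μ f ∧
    ∃ g : X → ℝ≥0∞, IsMinimalWeakUpperGradient Q μ g f ∧
      ∀ᵐ x ∂μ, g x ^ Q ≤ K * volumeDerivative μ ν f x

/-- The geometric condition: `Mod_Q(Γ) ≤ K Mod_Q(f(Γ))` for every family `Γ` of curves. -/
def GeometricCondition {X Y : Type*} [MetricSpace X] [MeasurableSpace X] [MetricSpace Y]
    [MeasurableSpace Y] (Q : ℝ) (K : ℝ≥0) (μ : Measure X) (ν : Measure Y) (f : X ≃ₜ Y) : Prop :=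
  ∀ Γ : Set (Curve X), modulus Q μ Γ ≤ K * modulus Q ν (Curve.map (f : C(X, Y)) '' Γ)

end QCMetric

end

namespace QCMetric

/-! The arc length of `γ` is treated as an atomless measure `arcMeasure` on the parameter line. Line
integrals along `γ`, along its subcurves and along `f ∘ γ` then become integrals over one line, and
"`f ∘ γ` is absolutely continuous with speed at most `g`" becomes an inequality of measures
(`IsGood`). A locally `Q`-integrable weak upper gradient `g` makes almost every curve good
(`IsWeakUpperGradient.isGood`).

Analytic to geometric: if `ρ` is admissible for `f(Γ)`, then `g · (ρ ∘ f)` is admissible for the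
good curves of `Γ`, and the other curves cost arbitrarily little. Since `g ^ Q ≤ K J_f` and `J_f dμ`
is at most the pulled back measure, the energy is at most `K ∫ ρ ^ Q dν`.

Geometric to analytic: let `V` be open with `ν (f '' V)` finite. The images of the curves in `V`
whose image end points are at least `1/n` apart have modulus at most `n ^ Q ν (f '' V)`, as the test
function `n · 1_{f(V)}` shows. The hypothesis gives functions on `X` which, divided by `n`, are
upper gradients on `V` up to an error `1/n`, with energy at most `K ν (f '' V) + ε` for every `n`.
Uniform convexity of `L^Q` yields one function that works for all `n`
(`exists_forall_mem_lintegral_rpow_le`), hence a true upper gradient on `V`. Gluing over a locally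
finite cover gives Sobolev regularity. Replacing the minimal gradient by the new function on `V`
(`IsGood.glue`) gives `∫_V g ^ Q ≤ K ν (f '' V)` for all such `V`, and outer regularity with
Lebesgue decomposition turns this into the pointwise bound. -/

/-- Finite measures on the line are compared on half-open intervals. -/
theorem measure_le_of_forall_Ioc {μ₁ μ₂ : Measure ℝ} [IsFiniteMeasure μ₁] [IsFiniteMeasure μ₂]
    (h : ∀ c d : ℝ, c ≤ d → μ₁ (Ioc c d) ≤ μ₂ (Ioc c d)) : μ₁ ≤ μ₂ := by
  have split : ∀ (m : Measure ℝ) [IsFiniteMeasure m] (s t : ℝ), s ≤ t →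
      m.real (Iic t) = m.real (Iic s) + m.real (Ioc s t) := by
    intro m _ s t hst
    rw [← measureReal_union _ measurableSet_Ioc, Iic_union_Ioc_eq_Iic hst]
    exact Set.disjoint_left.2 fun x hx hx' => absurd hx'.1 (not_lt.2 hx)
  have rc : ∀ (m : Measure ℝ) [IsFiniteMeasure m] (t : ℝ),
      ContinuousWithinAt (fun t => m.real (Iic t)) (Ici t) t := by
    intro m _ t
    rw [← continuousWithinAt_Ioi_iff_Ici]
    have := tendsto_measure_biInter_gt (μ := m) (s := fun r : ℝ => Iic r) (a := t)
      (fun r _ => measurableSet_Iic.nullMeasurableSet)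
      (fun i j _ hij => Iic_subset_Iic.2 hij) ⟨t + 1, by simp, measure_ne_top _ _⟩
    have e : (⋂ r, ⋂ (_ : r > t), Iic r) = Iic t := by
      ext x
      simp only [mem_iInter, mem_Iic]
      exact ⟨fun hx => le_of_forall_gt_imp_ge_of_dense fun r hr => hx r hr,
        fun hx r hr => hx.trans hr.le⟩
    rw [e] at this
    exact (ENNReal.tendsto_toReal (measure_ne_top _ _)).comp this
  -- The hypothesis says that the difference of the distribution functions is monotone, so it is the
  -- distribution function of a measure that fills the gap.
  let H : StieltjesFunction ℝ :=
    { toFun := fun t => μ₂.real (Iic t) - μ₁.real (Iic t)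
      mono' := by
        intro s t hst
        have h1 := split μ₁ s t hst
        have h2 := split μ₂ s t hst
        have h3 : μ₁.real (Ioc s t) ≤ μ₂.real (Ioc s t) :=
          ENNReal.toReal_mono (measure_ne_top _ _) (h s t hst)
        dsimp only
        linarith
      right_continuous' := fun t => (rc μ₂ t).sub (rc μ₁ t) }
  have key : μ₂ = μ₁ + H.measure := by
    refine Measure.ext_of_Ioc _ _ fun c d hcd => ?_
    have h1 := split μ₁ c d hcd.le
    have h2 := split μ₂ c d hcd.le
    rw [Measure.add_apply, StieltjesFunction.measure_Ioc]
    have : H d - H c = μ₂.real (Ioc c d) - μ₁.real (Ioc c d) := by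
      change (μ₂.real (Iic d) - μ₁.real (Iic d)) - (μ₂.real (Iic c) - μ₁.real (Iic c)) = _
      linarith
    rw [this, ENNReal.ofReal_sub _ measureReal_nonneg, ofReal_measureReal, ofReal_measureReal,
      add_tsub_cancel_of_le (h c d hcd.le)]
  rw [key]
  exact Measure.le_add_right le_rfl

/-! ### Variation measures of continuous paths -/

section VarMeasure

variable {X : Type*} [MetricSpace X]

/-- The variation measure of a path of bounded variation on the line. -/
noncomputable def varMeasure (U : ℝ → X) : Measure ℝ :=
  open Classical in
  if h : BoundedVariationOn U univ then
    (Monotone.stieltjesFunction (f := variationOnFromTo U univ 0) (monotoneOn_univ.1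
      (variationOnFromTo.monotoneOn h.locallyBoundedVariationOn (mem_univ 0)))).measure
  else 0

theorem continuous_variationOnFromTo {U : ℝ → X} (hU : Continuous U)
    (h : BoundedVariationOn U univ) (a : ℝ) : Continuous (variationOnFromTo U univ a) := by
  rw [continuous_iff_continuousAt]
  intro t
  rw [continuousAt_iff_continuous_left_right]
  constructor
  · rw [← continuousWithinAt_Iio_iff_Iic]
    have := variationOnFromTo.tendsto_left (l := U t) (mem_univ a) (mem_univ t)
      h.locallyBoundedVariationOn (hU.continuousAt.mono_left nhdsWithin_le_nhds)
    simpa [ContinuousWithinAt] using this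
  · exact h.continuousWithinAt_variationOnFromTo_Ici hU.continuousWithinAt

theorem varMeasure_Ioc {U : ℝ → X} (hU : Continuous U) (h : BoundedVariationOn U univ)
    {c d : ℝ} (hcd : c ≤ d) : varMeasure U (Ioc c d) = eVariationOn U (Icc c d) := by
  -- The Stieltjes function is built from right limits, which continuity makes harmless.
  have e : ∀ t, Function.rightLim (variationOnFromTo U univ 0) t = variationOnFromTo U univ 0 t :=
    fun t => ((continuous_variationOnFromTo hU h 0).continuousWithinAt).rightLim_eq
  rw [varMeasure, dif_pos h, StieltjesFunction.measure_Ioc, Monotone.stieltjesFunction_eq,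
    Monotone.stieltjesFunction_eq, e, e, variationOnFromTo.sub_right h.locallyBoundedVariationOn
      (mem_univ _) (mem_univ _) (mem_univ _), variationOnFromTo.eq_of_le _ _ hcd, univ_inter,
    ENNReal.ofReal_toReal (h.mono (subset_univ _))]

/-- Continuity excludes atoms: the variation over `[y, t]` tends to `0` as `y` increases to `t`.
This allows free passage between open, half-open and closed intervals. -/
theorem nullSingleton_varMeasure {U : ℝ → X} (hU : Continuous U) (h : BoundedVariationOn U univ) :
    NullSingletonClass (varMeasure U) := by
  refine ⟨fun t => ?_⟩
  have h1 : Tendsto (fun y => eVariationOn U (univ ∩ Icc y t)) (𝓝[univ] t) (𝓝 0) :=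
    h.tendsto_eVariationOn_Icc_zero_left hU.continuousWithinAt
  rw [nhdsWithin_univ] at h1
  have h2 := h1.mono_left (nhdsWithin_le_nhds (s := Iio t))
  refine le_antisymm (ge_of_tendsto h2 ?_) zero_le
  filter_upwards [self_mem_nhdsWithin] with y hy
  rw [univ_inter, ← varMeasure_Ioc hU h (le_of_lt hy)]
  exact measure_mono (singleton_subset_iff.2 ⟨hy, le_rfl⟩)

theorem varMeasure_Icc {U : ℝ → X} (hU : Continuous U) (h : BoundedVariationOn U univ)
    {c d : ℝ} (hcd : c ≤ d) : varMeasure U (Icc c d) = eVariationOn U (Icc c d) := by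
  have := nullSingleton_varMeasure hU h
  rw [← varMeasure_Ioc hU h hcd, measure_congr Ioc_ae_eq_Icc]

theorem varMeasure_univ_le {U : ℝ → X} (hU : Continuous U) (h : BoundedVariationOn U univ) :
    varMeasure U univ ≤ eVariationOn U univ := by
  have e : (univ : Set ℝ) = ⋃ n : ℕ, Icc (-(n : ℝ)) n := by
    refine (eq_univ_of_forall fun x => mem_iUnion.2 ?_).symm
    obtain ⟨n, hn⟩ := exists_nat_ge |x|
    exact ⟨n, abs_le.1 hn⟩
  have m : Monotone fun n : ℕ => Icc (-(n : ℝ)) n := fun i j hij =>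
    Icc_subset_Icc (neg_le_neg (Nat.cast_le.2 hij)) (Nat.cast_le.2 hij)
  conv_lhs => rw [e]
  rw [m.measure_iUnion]
  refine iSup_le fun n => ?_
  rw [varMeasure_Icc hU h (by have := n.cast_nonneg (α := ℝ); linarith)]
  exact eVariationOn.mono _ (subset_univ _)

theorem isFiniteMeasure_varMeasure {U : ℝ → X} (hU : Continuous U)
    (h : BoundedVariationOn U univ) : IsFiniteMeasure (varMeasure U) :=
  ⟨(varMeasure_univ_le hU h).trans_lt (lt_top_iff_ne_top.2 h)⟩

end VarMeasure

/-! ### Line integrals as integrals against arc length on the parameter interval -/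

namespace Curve

theorem continuous_extend {X : Type*} [TopologicalSpace X] (γ : Curve X) :
    Continuous γ.extend :=
  γ.toMap.continuous.Icc_extend'

theorem extend_mem_range {X : Type*} [TopologicalSpace X] (γ : Curve X) (t : ℝ) :
    γ.extend t ∈ range γ.toMap :=
  ⟨_, rfl⟩

theorem isCompact_range_extend {X : Type*} [TopologicalSpace X] (γ : Curve X) :
    IsCompact (range γ.extend) := by
  rw [extend, IccExtend_range]
  exact isCompact_range γ.toMap.continuous

theorem extend_a {X : Type*} [TopologicalSpace X] (γ : Curve X) : γ.extend γ.a = γ.source :=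
  IccExtend_left _ _

theorem extend_b {X : Type*} [TopologicalSpace X] (γ : Curve X) : γ.extend γ.b = γ.target :=
  IccExtend_right _ _

theorem extend_map {X Y : Type*} [TopologicalSpace X] [TopologicalSpace Y] (f : C(X, Y))
    (γ : Curve X) : (γ.map f).extend = f ∘ γ.extend := rfl

/-- The restriction of (the extension of) a curve to `[c, d]`. -/
noncomputable def sub {X : Type*} [TopologicalSpace X] (γ : Curve X) (c d : ℝ) (h : c ≤ d) : Curve X where
  a := c
  b := d
  le := h
  toMap := ⟨fun t => γ.extend t, γ.continuous_extend.comp continuous_subtype_val⟩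

theorem extend_sub_eqOn {X : Type*} [TopologicalSpace X] (γ : Curve X) {c d : ℝ} (h : c ≤ d) :
    EqOn (γ.sub c d h).extend γ.extend (Icc c d) := fun t ht => by
  exact IccExtend_of_mem (γ.sub c d h).le _ ht

theorem sub_source {X : Type*} [TopologicalSpace X] (γ : Curve X) {c d : ℝ} (h : c ≤ d) :
    (γ.sub c d h).source = γ.extend c := rfl

theorem sub_target {X : Type*} [TopologicalSpace X] (γ : Curve X) {c d : ℝ} (h : c ≤ d) :
    (γ.sub c d h).target = γ.extend d := rfl

variable {X : Type*} [MetricSpace X]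

/-- The extension factors through the monotone projection onto `[a, b]`, so it gains no variation
outside. -/
theorem eVariationOn_extend_univ (γ : Curve X) : eVariationOn γ.extend univ = γ.length := by
  refine le_antisymm ?_ (eVariationOn.mono _ (subset_univ _))
  have e : γ.extend = γ.extend ∘ fun t => (projIcc γ.a γ.b γ.le t : ℝ) := by
    funext t
    simp [extend, IccExtend]
  conv_lhs => rw [e]
  exact eVariationOn.comp_le_of_monotoneOn _ _
    (fun s _ t _ hst => monotone_projIcc γ.le hst) fun t _ => Subtype.coe_prop _

theorem Rectifiable.boundedVariationOn {γ : Curve X} (h : γ.Rectifiable) :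
    BoundedVariationOn γ.extend univ := by
  rw [BoundedVariationOn, eVariationOn_extend_univ]
  exact h.ne

theorem length_sub (γ : Curve X) {c d : ℝ} (h : c ≤ d) :
    (γ.sub c d h).length = eVariationOn γ.extend (Icc c d) :=
  eVariationOn.eq_of_eqOn (γ.extend_sub_eqOn h)

theorem Rectifiable.sub {γ : Curve X} (hγ : γ.Rectifiable) {c d : ℝ} (h : c ≤ d) :
    (γ.sub c d h).Rectifiable := by
  rw [Rectifiable, length_sub]
  exact lt_top_iff_ne_top.2 (hγ.boundedVariationOn.mono (subset_univ _))

/-- The arc-length measure of a curve, carried by its parameter interval. -/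
noncomputable def arcMeasure (γ : Curve X) : Measure ℝ := varMeasure γ.extend

theorem Rectifiable.isFiniteMeasure {γ : Curve X} (h : γ.Rectifiable) :
    IsFiniteMeasure γ.arcMeasure :=
  isFiniteMeasure_varMeasure γ.continuous_extend h.boundedVariationOn

theorem Rectifiable.nullSingleton {γ : Curve X} (h : γ.Rectifiable) :
    NullSingletonClass γ.arcMeasure :=
  nullSingleton_varMeasure γ.continuous_extend h.boundedVariationOn

theorem Rectifiable.arcMeasure_Icc {γ : Curve X} (h : γ.Rectifiable) {c d : ℝ} (hcd : c ≤ d) :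
    γ.arcMeasure (Icc c d) = eVariationOn γ.extend (Icc c d) :=
  varMeasure_Icc γ.continuous_extend h.boundedVariationOn hcd

theorem Rectifiable.arcMeasure_restrict {γ : Curve X} (h : γ.Rectifiable) :
    γ.arcMeasure.restrict (Icc γ.a γ.b) = γ.arcMeasure := by
  have := h.isFiniteMeasure
  rw [Measure.restrict_eq_self_of_ae_mem]
  change γ.arcMeasure (Icc γ.a γ.b)ᶜ = 0
  rw [measure_compl measurableSet_Icc (measure_ne_top _ _), tsub_eq_zero_iff_le,
    h.arcMeasure_Icc γ.le]
  refine (varMeasure_univ_le γ.continuous_extend h.boundedVariationOn).trans ?_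
  rw [eVariationOn_extend_univ, length]

/-- The arc-length parametrization pushes a measure with the right distribution function
to Lebesgue measure. -/
theorem map_variation_eq {γ : Curve X} (hγ : γ.Rectifiable) {m : Measure ℝ} [IsFiniteMeasure m]
    (hm : ∀ t ∈ Icc γ.a γ.b, m (Icc γ.a t) = eVariationOn γ.extend (Icc γ.a t)) :
    (m.restrict (Icc γ.a γ.b)).map (variationOnFromTo γ.extend univ γ.a) =
      volume.restrict (Icc 0 γ.length.toReal) := by
  set W := variationOnFromTo γ.extend univ γ.a with hW
  have bv := hγ.boundedVariationOn
  have Wmono : Monotone W :=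
    monotoneOn_univ.1 (variationOnFromTo.monotoneOn bv.locallyBoundedVariationOn (mem_univ _))
  have Wcont : Continuous W := continuous_variationOnFromTo γ.continuous_extend bv _
  have Wa : W γ.a = 0 := variationOnFromTo.self _ _ _
  have Wt : ∀ t, γ.a ≤ t → W t = (eVariationOn γ.extend (Icc γ.a t)).toReal := fun t ht => by
    rw [hW, variationOnFromTo.eq_of_le _ _ ht, univ_inter]
  have Wb : W γ.b = γ.length.toReal := Wt _ γ.le
  have mW : ∀ t ∈ Icc γ.a γ.b, m (Icc γ.a t) = ENNReal.ofReal (W t) := fun t ht => by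
    rw [hm t ht, Wt t ht.1, ENNReal.ofReal_toReal (bv.mono (subset_univ _))]
  refine Measure.ext_of_Iic _ _ fun y => ?_
  rw [Measure.map_apply Wmono.measurable measurableSet_Iic,
    Measure.restrict_apply (Wmono.measurable measurableSet_Iic),
    Measure.restrict_apply measurableSet_Iic]
  rcases lt_or_ge y 0 with hy | hy
  · have e1 : W ⁻¹' Iic y ∩ Icc γ.a γ.b = ∅ := by
      refine eq_empty_of_forall_notMem fun t ht => ?_
      have := Wmono ht.2.1
      have h2 : W t ≤ y := ht.1
      linarith
    have e2 : Iic y ∩ Icc 0 γ.length.toReal = ∅ :=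
      eq_empty_of_forall_notMem fun t ht => by
        have h1 : t ≤ y := ht.1
        have := ht.2.1
        linarith
    rw [e1, e2, measure_empty, measure_empty]
  rcases le_or_gt γ.length.toReal y with hy' | hy'
  · have e1 : W ⁻¹' Iic y ∩ Icc γ.a γ.b = Icc γ.a γ.b :=
      inter_eq_right.2 fun t ht => (Wmono ht.2).trans (Wb.trans_le hy')
    have e2 : Iic y ∩ Icc 0 γ.length.toReal = Icc 0 γ.length.toReal :=
      inter_eq_right.2 fun t ht => ht.2.trans hy'
    rw [e1, e2, mW _ (right_mem_Icc.2 γ.le), Wb, Real.volume_Icc, sub_zero]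
  · have hc : IsCompact (W ⁻¹' Iic y ∩ Icc γ.a γ.b) :=
      isCompact_Icc.inter_left (isClosed_Iic.preimage Wcont)
    -- `W` may have plateaus; the largest parameter with `W ≤ y` makes the sublevel set exactly `[a,
    -- t]`.
    obtain ⟨t, ht, hmax⟩ := hc.exists_isGreatest
      ⟨γ.a, show W γ.a ≤ y by rw [Wa]; exact hy, left_mem_Icc.2 γ.le⟩
    have hWt : W t = y := by
      refine le_antisymm ht.1 ?_
      obtain ⟨s, hs, hsy⟩ := intermediate_value_Icc ht.2.2 Wcont.continuousOn
        (show y ∈ Icc (W t) (W γ.b) from ⟨ht.1, by rw [Wb]; exact hy'.le⟩)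
      rw [← hsy]
      exact Wmono (hmax ⟨hsy.le, ht.2.1.trans hs.1, hs.2⟩)
    have e1 : W ⁻¹' Iic y ∩ Icc γ.a γ.b = Icc γ.a t := by
      ext s
      exact ⟨fun hs => ⟨hs.2.1, hmax hs⟩,
        fun hs => ⟨(Wmono hs.2).trans hWt.le, hs.1, hs.2.trans ht.2.2⟩⟩
    have e2 : Iic y ∩ Icc 0 γ.length.toReal = Icc 0 y := by
      ext s
      exact ⟨fun hs => ⟨hs.2.1, hs.1⟩, fun hs => ⟨hs.2, hs.1, hs.2.trans hy'.le⟩⟩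
    rw [e1, e2, mW _ ht.2, hWt, Real.volume_Icc, sub_zero]

variable [MeasurableSpace X] [BorelSpace X]

/-- Substitution along the arc-length function. The measure `m` is left free so that the arc measure
of a curve also serves all its subcurves. -/
theorem lineIntegral_eq_of_measure {γ : Curve X} (hγ : γ.Rectifiable) {m : Measure ℝ}
    [IsFiniteMeasure m]
    (hm : ∀ t ∈ Icc γ.a γ.b, m (Icc γ.a t) = eVariationOn γ.extend (Icc γ.a t))
    {ρ : X → ℝ≥0∞} (hρ : Measurable ρ) :
    γ.lineIntegral ρ = ∫⁻ t in Icc γ.a γ.b, ρ (γ.extend t) ∂m := by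
  have bv := hγ.boundedVariationOn
  have lbv : LocallyBoundedVariationOn γ.extend (Icc γ.a γ.b) :=
    (bv.mono (subset_univ _)).locallyBoundedVariationOn
  set W := variationOnFromTo γ.extend univ γ.a with hW
  have Wmono : Monotone W :=
    monotoneOn_univ.1 (variationOnFromTo.monotoneOn bv.locallyBoundedVariationOn (mem_univ _))
  have Wcont : Continuous W := continuous_variationOnFromTo γ.continuous_extend bv _
  have Weq : ∀ t ∈ Icc γ.a γ.b, variationOnFromTo γ.extend (Icc γ.a γ.b) γ.a t = W t := by
    intro t ht
    rw [hW, variationOnFromTo.eq_of_le _ _ ht.1, variationOnFromTo.eq_of_le _ _ ht.1, univ_inter,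
      inter_eq_right.2 (Icc_subset_Icc_right ht.2)]
  have arc : ∀ t ∈ Icc γ.a γ.b, γ.arcParam (W t) = γ.extend t := by
    intro t ht
    rw [← Weq t ht]
    exact edist_eq_zero.1 (edist_naturalParameterization_eq_zero lbv (left_mem_Icc.2 γ.le) ht)
  have Wa : W γ.a = 0 := variationOnFromTo.self _ _ _
  have Wb : W γ.b = γ.length.toReal := by
    rw [hW, variationOnFromTo.eq_of_le _ _ γ.le, univ_inter]; rfl
  -- Unit speed makes `arcParam` 1-Lipschitz, which supplies the measurability that its definition
  -- does not show.
  have cont : ContinuousOn γ.arcParam (Icc 0 γ.length.toReal) := by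
    have sp := has_unit_speed_naturalParameterization γ.extend lbv (left_mem_Icc.2 γ.le)
    have sub : Icc 0 γ.length.toReal ⊆
        variationOnFromTo γ.extend (Icc γ.a γ.b) γ.a '' Icc γ.a γ.b := by
      intro y hy
      rw [← Wa, ← Wb] at hy
      obtain ⟨t, ht, rfl⟩ := intermediate_value_Icc γ.le Wcont.continuousOn hy
      exact ⟨t, ht, Weq t ht⟩
    have lip : LipschitzOnWith 1 γ.arcParam (Icc 0 γ.length.toReal) := by
      intro x hx y hy
      wlog hxy : x ≤ y generalizing x y
      · rw [edist_comm, edist_comm x]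
        exact this hy hx (le_of_not_ge hxy)
      have h1 := sp (sub hx) (sub hy)
      refine (eVariationOn.edist_le _ (s := variationOnFromTo γ.extend (Icc γ.a γ.b) γ.a ''
        Icc γ.a γ.b ∩ Icc x y) ⟨sub hx, le_rfl, hxy⟩ ⟨sub hy, hxy, le_rfl⟩).trans ?_
      rw [arcParam, h1, NNReal.coe_one, one_mul, ENNReal.coe_one, one_mul, edist_dist,
        dist_comm, Real.dist_eq, abs_of_nonneg (sub_nonneg.2 hxy)]
    exact lip.continuousOn
  have meas : AEMeasurable (fun s => ρ (γ.arcParam s))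
      (volume.restrict (Icc 0 γ.length.toReal)) :=
    hρ.comp_aemeasurable (cont.aemeasurable measurableSet_Icc)
  rw [lineIntegral]
  rw [← map_variation_eq hγ hm] at meas ⊢
  rw [lintegral_map' meas Wmono.measurable.aemeasurable]
  exact setLIntegral_congr_fun measurableSet_Icc fun t ht => by rw [arc t ht]

theorem Rectifiable.lineIntegral_sub {γ : Curve X} (hγ : γ.Rectifiable) {c d : ℝ} (h : c ≤ d)
    {ρ : X → ℝ≥0∞} (hρ : Measurable ρ) :
    (γ.sub c d h).lineIntegral ρ = ∫⁻ t in Icc c d, ρ (γ.extend t) ∂γ.arcMeasure := by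
  have := hγ.isFiniteMeasure
  rw [lineIntegral_eq_of_measure (hγ.sub h) (m := γ.arcMeasure) _ hρ]
  · exact setLIntegral_congr_fun measurableSet_Icc fun t ht => by
      rw [γ.extend_sub_eqOn h ht]
  · intro t ht
    rw [hγ.arcMeasure_Icc ht.1]
    exact (eVariationOn.eq_of_eqOn fun s hs =>
      γ.extend_sub_eqOn h ⟨hs.1, hs.2.trans ht.2⟩).symm

theorem Rectifiable.lineIntegral_eq {γ : Curve X} (hγ : γ.Rectifiable)
    {ρ : X → ℝ≥0∞} (hρ : Measurable ρ) :
    γ.lineIntegral ρ = ∫⁻ t, ρ (γ.extend t) ∂γ.arcMeasure := by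
  have := hγ.isFiniteMeasure
  rw [lineIntegral_eq_of_measure hγ (m := γ.arcMeasure) (fun t ht => hγ.arcMeasure_Icc ht.1) hρ,
    hγ.arcMeasure_restrict]

theorem Rectifiable.lineIntegral_sub_le {γ : Curve X} (hγ : γ.Rectifiable) {c d : ℝ} (h : c ≤ d)
    {ρ : X → ℝ≥0∞} (hρ : Measurable ρ) :
    (γ.sub c d h).lineIntegral ρ ≤ γ.lineIntegral ρ := by
  rw [hγ.lineIntegral_sub h hρ, hγ.lineIntegral_eq hρ]
  exact setLIntegral_le_lintegral _ _

end Curve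

/-! ### Variation bounded by an integral -/

section Variation

/-- The half-open intervals of a partition are disjoint and, by order-connectedness, contained in
`s`, so the increments sum to at most the integral. -/
theorem eVariationOn_le_setLIntegral {Z : Type*} [MetricSpace Z] {u : ℝ → Z} {κ : Measure ℝ}
    [NullSingletonClass κ] {h : ℝ → ℝ≥0∞}
    (hu : ∀ c d, c ≤ d → edist (u c) (u d) ≤ ∫⁻ t in Icc c d, h t ∂κ)
    {s : Set ℝ} (hs : s.OrdConnected) : eVariationOn u s ≤ ∫⁻ t in s, h t ∂κ := by
  refine iSup_le ?_
  rintro ⟨n, w, hw, hws⟩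
  calc ∑ i ∈ Finset.range n, edist (u (w (i + 1))) (u (w i))
      ≤ ∑ i ∈ Finset.range n, ∫⁻ t in Ioc (w i) (w (i + 1)), h t ∂κ := by
        refine Finset.sum_le_sum fun i _ => ?_
        rw [edist_comm, setLIntegral_congr Ioc_ae_eq_Icc]
        exact hu _ _ (hw i.le_succ)
    _ = ∫⁻ t in ⋃ i ∈ Finset.range n, Ioc (w i) (w (i + 1)), h t ∂κ := by
        refine (lintegral_biUnion_finset ?_ (fun _ _ => measurableSet_Ioc) _).symm
        intro i _ j _ hij
        exact hw.pairwise_disjoint_on_Ioc_succ hij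
    _ ≤ ∫⁻ t in s, h t ∂κ := by
        refine lintegral_mono_set (iUnion₂_subset fun i _ => ?_)
        exact Ioc_subset_Icc_self.trans (hs.out (hws _) (hws _))

end Variation

/-! ### Suprema and scaling of functions with finite energy -/

section Null

variable {X : Type*} [MeasurableSpace X] {μ : Measure X} {p : ℝ}

/-- The power commutes with the supremum, and a supremum is at most the sum. Using suprema instead
of series avoids Minkowski's inequality. -/
theorem lintegral_iSup_rpow_le (hp : 0 < p) {h : ℕ → X → ℝ≥0∞} (hm : ∀ n, Measurable (h n)) :
    ∫⁻ x, (⨆ n, h n x) ^ p ∂μ ≤ ∑' n, ∫⁻ x, h n x ^ p ∂μ := by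
  rw [← lintegral_tsum fun n => ((hm n).pow_const p).aemeasurable]
  refine lintegral_mono fun x => ?_
  have := (ENNReal.orderIsoRpow p hp).map_iSup fun n => h n x
  simp only [ENNReal.orderIsoRpow_apply] at this
  rw [this]
  exact iSup_le fun n => ENNReal.le_tsum n

theorem exists_scale (hp : 0 < p) {I ε : ℝ≥0∞} (hI : I ≠ ∞) (hε : ε ≠ 0) :
    ∃ c : ℝ≥0∞, c ≠ 0 ∧ c ≠ ∞ ∧ c ^ p * I ≤ ε := by
  wlog h : ε ≠ ∞ generalizing ε
  · obtain ⟨c, h0, h1, -⟩ := this one_ne_zero ENNReal.one_ne_top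
    exact ⟨c, h0, h1, by rw [not_not.1 h]; exact le_top⟩
  -- Dividing by `I + 1` rather than `I` covers `I = 0`.
  have hI1 : I + 1 ≠ ∞ := ENNReal.add_ne_top.2 ⟨hI, ENNReal.one_ne_top⟩
  have hI0 : I + 1 ≠ 0 := (one_pos.trans_le le_add_self).ne'
  have h0 : ε / (I + 1) ≠ 0 := ENNReal.div_ne_zero.2 ⟨hε, hI1⟩
  have h1 : ε / (I + 1) ≠ ∞ := ENNReal.div_ne_top h hI0
  refine ⟨(ε / (I + 1)) ^ p⁻¹, ?_, ?_, ?_⟩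
  · exact (ENNReal.rpow_pos (pos_iff_ne_zero.2 h0) h1).ne'
  · exact ENNReal.rpow_ne_top_of_nonneg (inv_nonneg.2 hp.le) h1
  · rw [ENNReal.rpow_inv_rpow hp.ne']
    calc ε / (I + 1) * I ≤ ε / (I + 1) * (I + 1) := by gcongr; exact le_self_add
      _ = ε := ENNReal.div_mul_cancel hI0 hI1

theorem tsum_half_pow_ne_top : ∑' n : ℕ, (2⁻¹ : ℝ≥0∞) ^ n ≠ ∞ := by
  rw [ENNReal.tsum_geometric]
  simp

theorem lintegral_const_mul_rpow (hp : 0 < p) {c : ℝ≥0∞} (hc : c ≠ ∞) (h : X → ℝ≥0∞) :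
    ∫⁻ x, (c * h x) ^ p ∂μ = c ^ p * ∫⁻ x, h x ^ p ∂μ := by
  rw [← lintegral_const_mul' _ _ (ENNReal.rpow_ne_top_of_nonneg hp.le hc)]
  exact lintegral_congr fun x => ENNReal.mul_rpow_of_nonneg _ _ hp.le

/-- Countably many functions in `L^p` are dominated, up to constants, by a single one. -/
theorem exists_dominating (hp : 0 < p) {h : ℕ → X → ℝ≥0∞} (hm : ∀ n, Measurable (h n))
    (hi : ∀ n, ∫⁻ x, h n x ^ p ∂μ < ∞) :
    ∃ ρ : X → ℝ≥0∞, Measurable ρ ∧ ∫⁻ x, ρ x ^ p ∂μ < ∞ ∧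
      ∀ n, ∃ c : ℝ≥0∞, c ≠ ∞ ∧ ∀ x, h n x ≤ c * ρ x := by
  choose c c0 ct hc using fun n : ℕ => exists_scale hp (hi n).ne
    (pow_ne_zero n (ENNReal.inv_ne_zero.2 ENNReal.ofNat_ne_top) : (2⁻¹ : ℝ≥0∞) ^ n ≠ 0)
  refine ⟨fun x => ⨆ n, c n * h n x, .iSup fun n => (hm n).const_mul _, ?_, fun n => ?_⟩
  · refine (lintegral_iSup_rpow_le hp fun n => (hm n).const_mul _).trans_lt ?_
    refine lt_of_le_of_lt (ENNReal.tsum_le_tsum fun n => ?_)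
      (lt_top_iff_ne_top.2 tsum_half_pow_ne_top)
    rw [lintegral_const_mul_rpow hp (ct n)]
    exact hc n
  · refine ⟨(c n)⁻¹, ENNReal.inv_ne_top.2 (c0 n), fun x => ?_⟩
    calc h n x = (c n)⁻¹ * (c n * h n x) := by
          rw [← mul_assoc, ENNReal.inv_mul_cancel (c0 n) (ct n), one_mul]
      _ ≤ _ := by gcongr; exact le_iSup (fun n => c n * h n x) n

end Null

/-! ### Families of modulus zero -/

section Modulus

variable {X : Type*} [MetricSpace X]

theorem Curve.lineIntegral_mono (γ : Curve X) {ρ σ : X → ℝ≥0∞} (h : ∀ x, ρ x ≤ σ x) :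
    γ.lineIntegral ρ ≤ γ.lineIntegral σ :=
  lintegral_mono fun _ => h _

theorem Curve.lineIntegral_const_mul (γ : Curve X) {c : ℝ≥0∞} (hc : c ≠ ∞) (ρ : X → ℝ≥0∞) :
    γ.lineIntegral (fun x => c * ρ x) = c * γ.lineIntegral ρ :=
  lintegral_const_mul' _ _ hc

theorem Curve.lineIntegral_ne_top_of_le (γ : Curve X) {ρ σ : X → ℝ≥0∞} {c : ℝ≥0∞} (hc : c ≠ ∞)
    (h : ∀ x, ρ x ≤ c * σ x) (hσ : γ.lineIntegral σ ≠ ∞) : γ.lineIntegral ρ ≠ ∞ := by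
  refine ne_top_of_le_ne_top ?_ (γ.lineIntegral_mono h)
  rw [γ.lineIntegral_const_mul hc]
  exact ENNReal.mul_ne_top hc hσ

variable [MeasurableSpace X] {μ : Measure X} {p : ℝ}

theorem modulus_le {Γ : Set (Curve X)} {ρ : X → ℝ≥0∞} (h : Admissible ρ Γ) :
    modulus p μ Γ ≤ ∫⁻ x, ρ x ^ p ∂μ :=
  iInf₂_le ρ h

/-- Take admissible `ρ n` with `∫ (n ρ n) ^ p ≤ 2⁻ⁿ`: the supremum of the `n ρ n` has finite energy
and line integral at least every `n`. Together with its converse below, a null family is one on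
which a single function of finite energy has infinite integral. -/
theorem exists_lineIntegral_eq_top_of_modulus_eq_zero (hp : 0 < p) {Γ : Set (Curve X)}
    (h : modulus p μ Γ = 0) :
    ∃ ρ : X → ℝ≥0∞, Measurable ρ ∧ ∫⁻ x, ρ x ^ p ∂μ < ∞ ∧
      ∀ γ ∈ Γ, γ.Rectifiable → γ.lineIntegral ρ = ∞ := by
  have ex : ∀ n : ℕ, ∃ ρ : X → ℝ≥0∞, Admissible ρ Γ ∧
      ∫⁻ x, (n * ρ x) ^ p ∂μ ≤ 2⁻¹ ^ n := by
    intro n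
    have h2 : (2⁻¹ : ℝ≥0∞) ^ n ≠ 0 := pow_ne_zero n (ENNReal.inv_ne_zero.2 ENNReal.ofNat_ne_top)
    have hn : ((n : ℝ≥0∞)) ^ p ≠ ∞ :=
      ENNReal.rpow_ne_top_of_nonneg hp.le (ENNReal.natCast_ne_top n)
    have pos : 0 < (2⁻¹ : ℝ≥0∞) ^ n / ((n : ℝ≥0∞)) ^ p := ENNReal.div_pos h2 hn
    rw [← h, modulus] at pos
    obtain ⟨ρ, hρ⟩ := iInf_lt_iff.1 pos
    obtain ⟨ha, hρ⟩ := iInf_lt_iff.1 hρ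
    refine ⟨ρ, ha, ?_⟩
    rw [lintegral_const_mul_rpow hp (ENNReal.natCast_ne_top n)]
    exact ENNReal.mul_le_of_le_div' hρ.le
  choose ρ ha hi using ex
  have hm : ∀ n : ℕ, Measurable fun x => (n : ℝ≥0∞) * ρ n x := fun n => (ha n).1.const_mul _
  refine ⟨fun x => ⨆ n : ℕ, n * ρ n x, .iSup hm, ?_, fun γ hγ hr => ?_⟩
  · exact (lintegral_iSup_rpow_le hp hm).trans_lt
      (lt_of_le_of_lt (ENNReal.tsum_le_tsum hi) (lt_top_iff_ne_top.2 tsum_half_pow_ne_top))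
  · refine ENNReal.eq_top_of_forall_nnreal_le fun r => ?_
    obtain ⟨n, hn⟩ := exists_nat_ge r
    calc (r : ℝ≥0∞) ≤ n := by exact_mod_cast hn
      _ ≤ n * γ.lineIntegral (ρ n) := le_mul_of_one_le_right' ((ha n).2 γ hγ hr)
      _ = γ.lineIntegral (fun x => n * ρ n x) :=
        (γ.lineIntegral_const_mul (ENNReal.natCast_ne_top n) _).symm
      _ ≤ _ := γ.lineIntegral_mono fun x => le_iSup (fun n : ℕ => (n : ℝ≥0∞) * ρ n x) n

theorem modulus_eq_zero_of_lineIntegral_eq_top (hp : 0 < p) {Γ : Set (Curve X)} {ρ : X → ℝ≥0∞}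
    (hm : Measurable ρ) (hi : ∫⁻ x, ρ x ^ p ∂μ < ∞)
    (h : ∀ γ ∈ Γ, γ.Rectifiable → γ.lineIntegral ρ = ∞) : modulus p μ Γ = 0 := by
  refine le_antisymm (le_of_forall_pos_le_add fun ε hε => ?_) zero_le
  obtain ⟨c, c0, ct, hc⟩ := exists_scale hp hi.ne hε.ne'
  rw [zero_add]
  refine (iInf₂_le (fun x => c * ρ x) ⟨hm.const_mul c, fun γ hγ hr => ?admissible⟩).trans ?_
  case admissible =>
    rw [γ.lineIntegral_const_mul ct, h γ hγ hr, ENNReal.mul_top c0]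
    exact le_top
  · rwa [lintegral_const_mul_rpow hp ct]

end Modulus

/-! ### Curves along which the map is absolutely continuous -/

section Good

variable {X Y : Type*} [MetricSpace X] [MetricSpace Y]

/-- The curve `f ∘ γ` is absolutely continuous with respect to the arc length of `γ`, with speed
at most `g`, and `g` is integrable along `γ`. -/
structure IsGood (f : C(X, Y)) (g : X → ℝ≥0∞) (γ : Curve X) : Prop where
  rectifiable : γ.Rectifiable
  map_rectifiable : (γ.map f).Rectifiable
  lintegral_ne_top : ∫⁻ t, g (γ.extend t) ∂γ.arcMeasure ≠ ∞
  arcMeasure_map_le :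
    (γ.map f).arcMeasure ≤ γ.arcMeasure.withDensity fun t => g (γ.extend t)

/-- The end point inequality on all subintervals adds up over partitions to a bound on the
variation, hence on the arc measure of half-open intervals. -/
theorem isGood_of_forall_edist_le {f : C(X, Y)} {g : X → ℝ≥0∞} {γ : Curve X}
    (hγ : γ.Rectifiable) (hi : ∫⁻ t, g (γ.extend t) ∂γ.arcMeasure ≠ ∞)
    (h : ∀ c d, c ≤ d → edist (f (γ.extend c)) (f (γ.extend d)) ≤
      ∫⁻ t in Icc c d, g (γ.extend t) ∂γ.arcMeasure) : IsGood f g γ := by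
  have := hγ.nullSingleton
  have hr : (γ.map f).Rectifiable := by
    rw [Curve.Rectifiable, ← Curve.eVariationOn_extend_univ, Curve.extend_map]
    refine lt_of_le_of_lt (eVariationOn_le_setLIntegral h ordConnected_univ) ?_
    rw [setLIntegral_univ]
    exact lt_top_iff_ne_top.2 hi
  refine ⟨hγ, hr, hi, ?_⟩
  have := hr.isFiniteMeasure
  have := isFiniteMeasure_withDensity hi
  refine measure_le_of_forall_Ioc fun c d hcd => ?_
  rw [withDensity_apply _ measurableSet_Ioc, setLIntegral_congr Ioc_ae_eq_Icc]
  refine (measure_mono Ioc_subset_Icc_self).trans ?_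
  rw [hr.arcMeasure_Icc hcd]
  exact eVariationOn_le_setLIntegral h ordConnected_Icc

theorem IsGood.edist_le {f : C(X, Y)} {g : X → ℝ≥0∞} {γ : Curve X} (h : IsGood f g γ) :
    edist (f γ.source) (f γ.target) ≤ ∫⁻ t, g (γ.extend t) ∂γ.arcMeasure := by
  calc edist (f γ.source) (f γ.target)
      ≤ eVariationOn (γ.map f).extend (Icc γ.a γ.b) := by
        rw [← γ.extend_a, ← γ.extend_b]
        exact eVariationOn.edist_le (γ.map f).extend (left_mem_Icc.2 γ.le) (right_mem_Icc.2 γ.le)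
    _ = (γ.map f).arcMeasure (Icc γ.a γ.b) := (h.map_rectifiable.arcMeasure_Icc γ.le).symm
    _ ≤ γ.arcMeasure.withDensity (fun t => g (γ.extend t)) (Icc γ.a γ.b) :=
        h.arcMeasure_map_le _
    _ ≤ _ := by
        rw [withDensity_apply _ measurableSet_Icc]
        exact setLIntegral_le_lintegral _ _

/-- The density of the arc length of `f ∘ γ`. -/
theorem IsGood.exists_density {f : C(X, Y)} {g : X → ℝ≥0∞} {γ : Curve X} (h : IsGood f g γ) :
    ∃ k : ℝ → ℝ≥0∞, Measurable k ∧ (γ.map f).arcMeasure = γ.arcMeasure.withDensity k := by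
  have := h.rectifiable.isFiniteMeasure
  have := h.map_rectifiable.isFiniteMeasure
  have ac : (γ.map f).arcMeasure ≪ γ.arcMeasure :=
    (Measure.absolutelyContinuous_of_le h.arcMeasure_map_le).trans
      (withDensity_absolutelyContinuous _ _)
  exact ⟨_, Measure.measurable_rnDeriv _ _, (Measure.withDensity_rnDeriv_eq _ _ ac).symm⟩

theorem IsGood.density_le {f : C(X, Y)} {g : X → ℝ≥0∞} {γ : Curve X} (h : IsGood f g γ)
    {k : ℝ → ℝ≥0∞} (hk : Measurable k)
    (e : (γ.map f).arcMeasure = γ.arcMeasure.withDensity k) :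
    k ≤ᵐ[γ.arcMeasure] fun t => g (γ.extend t) := by
  have := h.rectifiable.isFiniteMeasure
  refine ae_le_of_forall_setLIntegral_le_of_sigmaFinite hk fun s hs _ => ?_
  rw [← withDensity_apply _ hs, ← withDensity_apply _ hs, ← e]
  exact h.arcMeasure_map_le s

theorem IsGood.of_density {f : C(X, Y)} {g g' : X → ℝ≥0∞} {γ : Curve X} (h : IsGood f g γ)
    {k : ℝ → ℝ≥0∞} (e : (γ.map f).arcMeasure = γ.arcMeasure.withDensity k)
    (hk : k ≤ᵐ[γ.arcMeasure] fun t => g' (γ.extend t))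
    (hi : ∫⁻ t, g' (γ.extend t) ∂γ.arcMeasure ≠ ∞) : IsGood f g' γ :=
  ⟨h.rectifiable, h.map_rectifiable, hi, by rw [e]; exact withDensity_mono hk⟩

/-- The arc-length density of `f ∘ γ` does not depend on `g`; it lies a.e. below each `g n`, hence
below the infimum. -/
theorem IsGood.iInf {f : C(X, Y)} {g : ℕ → X → ℝ≥0∞} {γ : Curve X} (h : ∀ n, IsGood f (g n) γ) : IsGood f (fun x => ⨅ n, g n x) γ := by
  obtain ⟨k, hk, e⟩ := (h 0).exists_density
  refine (h 0).of_density e ?_ ?_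
  · filter_upwards [ae_all_iff.2 fun n => (h n).density_le hk e] with t ht
    exact le_iInf ht
  · exact ne_top_of_le_ne_top (h 0).lintegral_ne_top (lintegral_mono fun t => iInf_le _ 0)

variable [MeasurableSpace X] [BorelSpace X]

theorem measurable_comp_extend {g : X → ℝ≥0∞} (hg : Measurable g) (γ : Curve X) :
    Measurable fun t => g (γ.extend t) :=
  hg.comp γ.continuous_extend.measurable

/-- Changing `g` on an open set `V` to a function that controls `f` along curves in `V`. -/
theorem IsGood.glue {f : C(X, Y)} {g h : X → ℝ≥0∞} {γ : Curve X} {V : Set X}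
    [DecidablePred (· ∈ V)] (hγ : IsGood f g γ)
    (hh : Measurable h) (hV : IsOpen V)
    (hi : ∫⁻ t, h (γ.extend t) ∂γ.arcMeasure ≠ ∞)
    (hc : ∀ c d, c ≤ d → (∀ t ∈ Icc c d, γ.extend t ∈ V) →
      edist (f (γ.extend c)) (f (γ.extend d)) ≤ ∫⁻ t in Icc c d, h (γ.extend t) ∂γ.arcMeasure) :
    IsGood f (fun x => if x ∈ V then h x else g x) γ := by
  obtain ⟨k, hk, e⟩ := hγ.exists_density
  have fin := hγ.rectifiable.isFiniteMeasure
  have na := hγ.rectifiable.nullSingleton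
  have fin' := hγ.map_rectifiable.isFiniteMeasure
  have hO : IsOpen (γ.extend ⁻¹' V) := hV.preimage γ.continuous_extend
  -- Rational intervals exhaust the open set `γ⁻¹(V)`, and there are countably many, so their
  -- exceptional null sets can be united.
  have loc : ∀ q : ℚ × ℚ, Icc (q.1 : ℝ) q.2 ⊆ γ.extend ⁻¹' V →
      ∀ᵐ t ∂γ.arcMeasure, t ∈ Icc (q.1 : ℝ) q.2 → k t ≤ h (γ.extend t) := by
    intro q hq
    rw [← ae_restrict_iff' measurableSet_Icc]
    have fw := isFiniteMeasure_withDensity hi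
    have key : (γ.map f).arcMeasure.restrict (Icc (q.1 : ℝ) q.2) ≤
        (γ.arcMeasure.withDensity fun t => h (γ.extend t)).restrict (Icc (q.1 : ℝ) q.2) := by
      refine measure_le_of_forall_Ioc fun c d _ => ?_
      rw [Measure.restrict_apply measurableSet_Ioc, Measure.restrict_apply measurableSet_Ioc]
      have sub : ∀ t ∈ Icc (max c q.1) (min d q.2), γ.extend t ∈ V := fun t ht =>
        hq ⟨(le_max_right _ _).trans ht.1, ht.2.trans (min_le_right _ _)⟩
      have sub' : Ioc c d ∩ Icc (q.1 : ℝ) q.2 ⊆ Icc (max c q.1) (min d q.2) := fun t ht =>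
        ⟨max_le ht.1.1.le ht.2.1, le_min ht.1.2 ht.2.2⟩
      rcases lt_or_ge (min d (q.2 : ℝ)) (max c q.1) with hlt | hle
      · rw [Icc_eq_empty (not_le.2 hlt), subset_empty_iff] at sub'
        rw [sub', measure_empty, measure_empty]
      have ae : (Ioc c d ∩ Icc (q.1 : ℝ) q.2 : Set ℝ) =ᵐ[γ.arcMeasure]
          Icc (max c q.1) (min d q.2) := by
        rw [← Icc_inter_Icc]
        exact Ioc_ae_eq_Icc.inter .rfl
      rw [withDensity_apply _ (measurableSet_Ioc.inter measurableSet_Icc),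
        setLIntegral_congr ae]
      refine (measure_mono sub').trans ?_
      rw [hγ.map_rectifiable.arcMeasure_Icc hle]
      -- `hc` only covers intervals mapped into `V`. Projecting parameters onto such an interval
      -- gives an inequality for all `c' ≤ d'`, with `h` cut off outside it.
      have : ∀ c' d', c' ≤ d' → edist ((γ.map f).extend (projIcc _ _ hle c'))
          ((γ.map f).extend (projIcc _ _ hle d')) ≤
            ∫⁻ t in Icc c' d', (Icc (max c q.1) (min d q.2)).indicator
              (fun t => h (γ.extend t)) t ∂γ.arcMeasure := by
        intro c' d' hcd
        rw [lintegral_indicator measurableSet_Icc, Measure.restrict_restrict measurableSet_Icc]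
        have hm := monotone_projIcc hle hcd
        refine (hc _ _ hm fun t ht => sub t ⟨(projIcc _ _ hle c').2.1.trans ht.1,
          ht.2.trans (projIcc _ _ hle d').2.2⟩).trans ?_
        -- If `[c', d']` misses the interval, both projections coincide; the open interval is then
        -- empty, and end points carry no mass.
        have hsub : Ioo (projIcc _ _ hle c' : ℝ) (projIcc _ _ hle d') ⊆
            Icc (max c q.1) (min d q.2) ∩ Icc c' d' := by
          intro t ht
          refine ⟨⟨(projIcc _ _ hle c').2.1.trans ht.1.le, ht.2.le.trans (projIcc _ _ hle d').2.2⟩,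
            ?_, ?_⟩
          · by_contra hlt
            rw [not_le] at hlt
            have h1 : t < min (min d q.2 : ℝ) c' := lt_min
              (ht.2.trans_le (projIcc _ _ hle d').2.2) hlt
            have h2 : (projIcc _ _ hle c' : ℝ) = max (max c q.1) (min (min d q.2) c') :=
              coe_projIcc _ _ hle c'
            have h3 := ht.1
            rw [h2] at h3
            exact absurd h1 (not_lt.2 ((le_max_right _ _).trans h3.le))
          · by_contra hlt
            rw [not_le] at hlt
            have h2 : (projIcc _ _ hle d' : ℝ) = max (max c q.1) (min (min d q.2) d') :=
              coe_projIcc _ _ hle d'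
            have h3 := ht.2
            rw [h2] at h3
            rcases lt_max_iff.1 h3 with h4 | h4
            · exact absurd h4 (not_lt.2 ((projIcc _ _ hle c').2.1.trans ht.1.le))
            · exact absurd hlt (not_lt.2 (h4.le.trans (min_le_right _ _)))
        rw [← setLIntegral_congr Ioo_ae_eq_Icc]
        exact lintegral_mono_set hsub
      have h4 := eVariationOn_le_setLIntegral this
        (ordConnected_Icc (a := max c (q.1 : ℝ)) (b := min d q.2))
      rw [lintegral_indicator measurableSet_Icc, Measure.restrict_restrict measurableSet_Icc,
        inter_self] at h4
      refine le_of_eq_of_le (eVariationOn.eq_of_eqOn fun t ht => ?_) h4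
      rw [projIcc_of_mem hle ht]
    refine ae_le_of_forall_setLIntegral_le_of_sigmaFinite hk fun s hs _ => ?_
    have := key s
    rwa [e, restrict_withDensity measurableSet_Icc, restrict_withDensity measurableSet_Icc,
      withDensity_apply _ hs, withDensity_apply _ hs] at this
  have cov : ∀ t, γ.extend t ∈ V → ∃ q : ℚ × ℚ, Icc (q.1 : ℝ) q.2 ⊆ γ.extend ⁻¹' V ∧
      t ∈ Icc (q.1 : ℝ) q.2 := by
    intro t ht
    obtain ⟨ε, hε, hb⟩ := Metric.isOpen_iff.1 hO t ht
    obtain ⟨p, hp1, hp2⟩ := exists_rat_btwn (sub_lt_self t hε)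
    obtain ⟨q, hq1, hq2⟩ := exists_rat_btwn (lt_add_of_pos_right t hε)
    refine ⟨(p, q), fun s hs => hb ?_, hp2.le, hq1.le⟩
    rw [Real.ball_eq_Ioo]
    exact ⟨hp1.trans_le hs.1, hs.2.trans_lt hq2⟩
  refine hγ.of_density e ?_ ?_
  · have all : ∀ᵐ t ∂γ.arcMeasure, ∀ q : ℚ × ℚ, Icc (q.1 : ℝ) q.2 ⊆ γ.extend ⁻¹' V →
        t ∈ Icc (q.1 : ℝ) q.2 → k t ≤ h (γ.extend t) := by
      rw [ae_all_iff]
      intro q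
      by_cases hq : Icc (q.1 : ℝ) q.2 ⊆ γ.extend ⁻¹' V
      · filter_upwards [loc q hq] with t ht _ using ht
      · exact .of_forall fun t h' => absurd h' hq
    filter_upwards [all, hγ.density_le hk e] with t ht ht'
    split_ifs with hV'
    · obtain ⟨q, hq, hqt⟩ := cov t hV'
      exact ht q hq hqt
    · exact ht'
  · refine ne_top_of_le_ne_top (ENNReal.add_ne_top.2 ⟨hi, hγ.lintegral_ne_top⟩) ?_
    rw [← lintegral_add_left (measurable_comp_extend hh γ)]
    refine lintegral_mono fun t => ?_
    dsimp only
    split_ifs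
    · exact le_self_add
    · exact le_add_self

end Good

/-! ### Weak upper gradients, almost every curve, and minimality -/

section Weak

variable {X Y : Type*} [MetricSpace X] [MeasurableSpace X] [BorelSpace X] [MetricSpace Y]
  {μ : Measure X} {p : ℝ}

/-- Almost every curve, in the sense of modulus, has the property `P`. -/
def AlmostEveryCurve (p : ℝ) (μ : Measure X) (P : Curve X → Prop) : Prop :=
  ∃ ρ : X → ℝ≥0∞, Measurable ρ ∧ ∫⁻ x, ρ x ^ p ∂μ < ∞ ∧
    ∀ γ : Curve X, γ.Rectifiable → γ.lineIntegral ρ ≠ ∞ → P γ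

omit [BorelSpace X] in
-- Countable unions of null families are null: one function dominates all the exceptional weights up
-- to constants.
theorem AlmostEveryCurve.all (hp : 0 < p) {P : ℕ → Curve X → Prop}
    (h : ∀ n, AlmostEveryCurve p μ (P n)) : AlmostEveryCurve p μ fun γ => ∀ n, P n γ := by
  choose ρ hm hi hP using h
  obtain ⟨σ, σm, σi, hσ⟩ := exists_dominating hp hm hi
  refine ⟨σ, σm, σi, fun γ hγ hne n => ?_⟩
  obtain ⟨c, ct, hc⟩ := hσ n
  exact hP n γ hγ (γ.lineIntegral_ne_top_of_le ct hc hne)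

omit [BorelSpace X] in
theorem AlmostEveryCurve.and (hp : 0 < p) {P P' : Curve X → Prop}
    (h : AlmostEveryCurve p μ P) (h' : AlmostEveryCurve p μ P') :
    AlmostEveryCurve p μ fun γ => P γ ∧ P' γ := by
  have := AlmostEveryCurve.all hp (P := fun n => if n = 0 then P else P') (μ := μ) fun n => by
    split_ifs
    exacts [h, h']
  obtain ⟨ρ, hm, hi, hP⟩ := this
  exact ⟨ρ, hm, hi, fun γ hγ hne => ⟨by simpa using hP γ hγ hne 0, by simpa using hP γ hγ hne 1⟩⟩

omit [BorelSpace X] in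
theorem AlmostEveryCurve.mono {P P' : Curve X → Prop}
    (h : AlmostEveryCurve p μ P) (h' : ∀ γ : Curve X, P γ → P' γ) : AlmostEveryCurve p μ P' := by
  obtain ⟨ρ, hm, hi, hP⟩ := h
  exact ⟨ρ, hm, hi, fun γ hγ hne => h' γ (hP γ hγ hne)⟩

theorem exists_seq_cover_nhds {X : Type*} [TopologicalSpace X] [SecondCountableTopology X]
    [Nonempty X] {U : X → Set X} (hU : ∀ x, U x ∈ 𝓝 x) : ∃ e : ℕ → X, ⋃ n, U (e n) = univ := by
  obtain ⟨s, hs, hcov⟩ := TopologicalSpace.countable_cover_nhds hU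
  have sne : s.Nonempty := by
    rw [nonempty_iff_ne_empty]
    rintro rfl
    simp only [mem_empty_iff_false, iUnion_of_empty, iUnion_empty] at hcov
    exact empty_ne_univ hcov
  obtain ⟨e, rfl⟩ := hs.exists_eq_range sne
  exact ⟨e, by rwa [biUnion_range] at hcov⟩

/-- A locally `p`-integrable function is integrable along almost every curve. -/
theorem LocIntegrablePow.almostEveryCurve [SecondCountableTopology X] (hp : 0 < p)
    {g : X → ℝ≥0∞} (hg : Measurable g) (hl : LocIntegrablePow p μ g) :
    AlmostEveryCurve p μ fun γ => γ.Rectifiable ∧ ∫⁻ t, g (γ.extend t) ∂γ.arcMeasure ≠ ∞ := by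
  choose U hU hxU hi using hl
  rcases isEmpty_or_nonempty X with hX | hX
  · exact ⟨0, measurable_zero, by simp, fun γ => isEmptyElim γ.source⟩
  obtain ⟨e, hcov⟩ := exists_seq_cover_nhds fun x => (hU x).mem_nhds (hxU x)
  have hae : AlmostEveryCurve p μ fun γ => ∀ n, γ.Rectifiable ∧
      γ.lineIntegral ((U (e n)).indicator g) ≠ ∞ := by
    refine AlmostEveryCurve.all hp fun n =>
      ⟨(U (e n)).indicator g, hg.indicator (hU _).measurableSet, ?_, fun γ hγ h => ⟨hγ, h⟩⟩
    refine lt_of_eq_of_lt ?_ (hi (e n))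
    rw [← lintegral_indicator (hU _).measurableSet]
    refine lintegral_congr fun x => ?_
    by_cases hx : x ∈ U (e n)
    · simp [hx]
    · simp [hx, hp]
  refine hae.mono fun γ hγ => ⟨(hγ 0).1, ?_⟩
  have hr := (hγ 0).1
  -- By compactness the curve meets only finitely many pieces essentially, so a finite sum of finite
  -- integrals bounds the integral of `g`.
  obtain ⟨F, hF⟩ := γ.isCompact_range_extend.elim_finite_subcover (fun n => U (e n))
    (fun n => hU _) fun x _ => hcov ▸ mem_univ x
  refine ne_top_of_le_ne_top (b := ∑ n ∈ F, γ.lineIntegral ((U (e n)).indicator g))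
    (ENNReal.sum_ne_top.2 fun n _ => (hγ n).2) ?_
  have hm : ∀ n, Measurable ((U (e n)).indicator g) := fun n =>
    hg.indicator (hU _).measurableSet
  rw [Finset.sum_congr rfl fun n _ => hr.lineIntegral_eq (hm n),
    ← lintegral_finsetSum _ fun n _ => measurable_comp_extend (hm n) γ]
  refine lintegral_mono fun t => ?_
  obtain ⟨n, hn, ht⟩ := mem_iUnion₂.1 (hF (mem_range_self t))
  calc g (γ.extend t) = (U (e n)).indicator g (γ.extend t) := (indicator_of_mem ht g).symm
    _ ≤ _ := Finset.single_le_sum (f := fun n => (U (e n)).indicator g (γ.extend t))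
        (fun _ _ => zero_le) hn

/-- If a subcurve is exceptional, the weight `ρ` has infinite integral over it and so over the whole
curve. Thus almost every curve satisfies the inequality on all its subcurves. -/
theorem IsWeakUpperGradient.isGood [SecondCountableTopology X] (hp : 0 < p) {f : C(X, Y)}
    {g : X → ℝ≥0∞} (h : IsWeakUpperGradient p μ g f) (hl : LocIntegrablePow p μ g) :
    AlmostEveryCurve p μ (IsGood f g) := by
  obtain ⟨ρ, hm, hi, hρ⟩ := exists_lineIntegral_eq_top_of_modulus_eq_zero hp h.2
  have h1 : AlmostEveryCurve p μ fun γ => γ.lineIntegral ρ ≠ ∞ := ⟨ρ, hm, hi, fun _ _ h => h⟩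
  refine (h1.and hp (hl.almostEveryCurve hp h.1)).mono fun γ hγ => ?_
  obtain ⟨hne, hr, hg⟩ := hγ
  refine isGood_of_forall_edist_le hr hg fun c d hcd => ?_
  by_contra hcon
  refine ne_top_of_le_ne_top hne (hr.lineIntegral_sub_le hcd hm)
    (hρ (γ.sub c d hcd) ⟨hr.sub hcd, ?_⟩ (hr.sub hcd))
  rwa [hr.lineIntegral_sub hcd h.1]

theorem isWeakUpperGradient_of_isGood (hp : 0 < p) {f : C(X, Y)}
    {g : X → ℝ≥0∞} (hg : Measurable g) (h : AlmostEveryCurve p μ (IsGood f g)) :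
    IsWeakUpperGradient p μ g f := by
  obtain ⟨ρ, hm, hi, hρ⟩ := h
  refine ⟨hg, modulus_eq_zero_of_lineIntegral_eq_top hp hm hi fun γ hγ hr => ?_⟩
  by_contra hne
  refine hγ.2 ?_
  rw [hr.lineIntegral_eq hg]
  exact (hρ γ hr hne).edist_le

omit [BorelSpace X] in
theorem IsUpperGradient.isWeakUpperGradient (hp : 0 < p) {f : C(X, Y)} {g : X → ℝ≥0∞}
    (h : IsUpperGradient g f) : IsWeakUpperGradient p μ g f :=
  ⟨h.1, modulus_eq_zero_of_lineIntegral_eq_top hp measurable_zero (by simp [hp])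
    fun γ hγ hr => absurd (h.2 γ hr) hγ.2⟩

theorem IsWeakUpperGradient.iInf [SecondCountableTopology X] (hp : 0 < p) {f : C(X, Y)}
    {g : ℕ → X → ℝ≥0∞} (h : ∀ n, IsWeakUpperGradient p μ (g n) f)
    (hl : ∀ n, LocIntegrablePow p μ (g n)) :
    IsWeakUpperGradient p μ (fun x => ⨅ n, g n x) f :=
  isWeakUpperGradient_of_isGood hp (.iInf fun n => (h n).1)
    ((AlmostEveryCurve.all hp fun n => (h n).isGood hp (hl n)).mono fun _ hγ => .iInf hγ)

omit [BorelSpace X] in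
theorem LocIntegrablePow.mono (hp : 0 < p) {g h : X → ℝ≥0∞} (hl : LocIntegrablePow p μ g)
    (hgh : ∀ x, h x ≤ g x) : LocIntegrablePow p μ h := fun x => by
  obtain ⟨U, hU, hx, hi⟩ := hl x
  exact ⟨U, hU, hx, (lintegral_mono fun y => ENNReal.rpow_le_rpow (hgh y) hp.le).trans_lt hi⟩

/-- A function that has a locally `p`-integrable weak upper gradient has a minimal one. -/
theorem exists_isMinimalWeakUpperGradient [SecondCountableTopology X] [SigmaFinite μ] (hp : 0 < p)
    {f : C(X, Y)} {g₀ : X → ℝ≥0∞} (h₀ : IsWeakUpperGradient p μ g₀ f)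
    (hl₀ : LocIntegrablePow p μ g₀) :
    ∃ g : X → ℝ≥0∞, IsMinimalWeakUpperGradient p μ g f := by
  obtain ⟨P, hP, hμP, hPμ⟩ := exists_isFiniteMeasure_absolutelyContinuous μ
  let S : Set (X → ℝ≥0∞) := {g | IsWeakUpperGradient p μ g f ∧ LocIntegrablePow p μ g}
  -- A finite, strictly decreasing functional: maximizing it singles out the a.e. smallest gradient
  -- without requiring global integrability.
  let J : (X → ℝ≥0∞) → ℝ≥0∞ := fun g => ∫⁻ x, (1 + g x)⁻¹ ∂P
  have J_mono : ∀ g h : X → ℝ≥0∞, (∀ x, g x ≤ h x) → J h ≤ J g := fun g h hgh =>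
    lintegral_mono fun x => ENNReal.inv_le_inv.2 (add_le_add_right (hgh x) 1)
  have J_top : ∀ g, J g ≠ ∞ := fun g => by
    refine ne_top_of_le_ne_top (measure_ne_top P univ) ?_
    rw [← lintegral_one]
    exact lintegral_mono fun x => ENNReal.inv_le_one.2 le_self_add
  have inf_mem : ∀ g : ℕ → X → ℝ≥0∞, (∀ n, g n ∈ S) → (fun x => ⨅ n, g n x) ∈ S := fun g hg =>
    ⟨.iInf hp (fun n => (hg n).1) fun n => (hg n).2,
      (hg 0).2.mono hp fun x => iInf_le (fun n => g n x) 0⟩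
  have Sne : (J '' S).Nonempty := ⟨J g₀, g₀, ⟨h₀, hl₀⟩, rfl⟩
  obtain ⟨u, -, hu, huS⟩ := exists_seq_tendsto_sSup Sne (OrderTop.bddAbove _)
  choose g hgS hgu using huS
  have hG := inf_mem g hgS
  set G : X → ℝ≥0∞ := fun x => ⨅ n, g n x with hGdef
  have hJG : ∀ h ∈ S, J h ≤ J G := fun h hh => by
    refine (le_sSup (mem_image_of_mem J hh)).trans (le_of_tendsto' hu fun n => ?_)
    rw [← hgu n]
    exact J_mono _ _ fun x => iInf_le (fun n => g n x) n
  refine ⟨G, hG.1, hG.2, fun g' hg' hl' => ?_⟩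
  -- The minimum of `G` and `g'`, written as a countable infimum to use `inf_mem`. Maximality of `J
  -- G` forces `H = G` a.e.
  let H : X → ℝ≥0∞ := fun x => ⨅ n : ℕ, if n = 0 then G x else g' x
  have hH : H ∈ S := inf_mem (fun n => if n = 0 then G else g') (fun n => by
    split_ifs
    exacts [hG, ⟨hg', hl'⟩]) |> fun h => by
      convert h using 4 with x n
      split_ifs <;> rfl
  have hHG : ∀ x, H x ≤ G x := fun x =>
    (iInf_le (fun n : ℕ => if n = 0 then G x else g' x) 0).trans (by simp)
  have hHg : ∀ x, H x ≤ g' x := fun x =>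
    (iInf_le (fun n : ℕ => if n = 0 then G x else g' x) 1).trans (by simp)
  have key : (fun x => (1 + G x)⁻¹) =ᵐ[P] fun x => (1 + H x)⁻¹ :=
    ae_eq_of_ae_le_of_lintegral_le
      (.of_forall fun x => ENNReal.inv_le_inv.2 (add_le_add_right (hHG x) 1)) (J_top G)
      (hH.1.1.const_add 1).inv.aemeasurable (hJG H hH)
  filter_upwards [hμP.ae_le key] with x hx
  have hx' : 1 + G x = 1 + H x := inv_injective hx
  rw [(ENNReal.add_right_inj ENNReal.one_ne_top).1 hx']
  exact hHg x

end Weak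

/-! ### From the analytic to the geometric condition -/

section Geometric

variable {X Y : Type*} [MetricSpace X] [MeasurableSpace X] [BorelSpace X]
  [MetricSpace Y] [MeasurableSpace Y] [BorelSpace Y] {μ : Measure X} {ν : Measure Y} {Q : ℝ}

theorem IsGood.lineIntegral_map_le {f : C(X, Y)} {g : X → ℝ≥0∞} {γ : Curve X}
    (h : IsGood f g γ) (hg : Measurable g) {ρ : Y → ℝ≥0∞} (hρ : Measurable ρ) :
    (γ.map f).lineIntegral ρ ≤ γ.lineIntegral fun x => g x * ρ (f x) := by
  have hρf : Measurable fun x => ρ (f x) := hρ.comp f.continuous.measurable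
  rw [h.map_rectifiable.lineIntegral_eq hρ,
    h.rectifiable.lineIntegral_eq (ρ := fun x => g x * ρ (f x)) (hg.mul hρf)]
  refine (lintegral_mono' h.arcMeasure_map_le le_rfl).trans ?_
  rw [lintegral_withDensity_eq_lintegral_mul _ (measurable_comp_extend hg γ)
    (measurable_comp_extend hρ _)]
  rfl

theorem AnalyticCondition.geometricCondition [SecondCountableTopology X] (hQ : 0 < Q) {K : ℝ≥0} (hK : 0 < K)
    {f : X ≃ₜ Y} (h : AnalyticCondition Q K μ ν f) : GeometricCondition Q K μ ν f := by
  obtain ⟨-, g, ⟨hw, hl, -⟩, hgK⟩ := h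
  obtain ⟨ρ₀, hm₀, hi₀, hgood⟩ := IsWeakUpperGradient.isGood (f := (f : C(X, Y))) hQ hw hl
  have hg := hw.1
  intro Γ
  have hK0 : (K : ℝ≥0∞) ≠ 0 := ENNReal.coe_ne_zero.2 hK.ne'
  conv_rhs => rw [modulus]
  simp_rw [ENNReal.mul_iInf_of_ne hK0 ENNReal.coe_ne_top]
  refine le_iInf₂ fun ρ hρ => le_of_forall_pos_le_add fun ε hε => ?_
  obtain ⟨c, c0, ct, hc⟩ := exists_scale hQ hi₀.ne hε.ne'
  have hρf : Measurable fun x => ρ (f x) := hρ.1.comp f.continuous.measurable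
  -- The first term handles good curves; the second has infinite integral on the others and energy
  -- at most `ε`.
  refine (iInf₂_le (fun x => max (g x * ρ (f x)) (c * ρ₀ x))
    ⟨(hg.mul hρf).max (hm₀.const_mul c), fun γ hγ hr => ?admissible⟩).trans ?_
  case admissible =>
    by_cases hne : γ.lineIntegral ρ₀ = ∞
    · refine le_trans ?_ (γ.lineIntegral_mono fun x => le_max_right _ _)
      rw [γ.lineIntegral_const_mul ct, hne, ENNReal.mul_top c0]
      exact le_top
    · have good := hgood γ hr hne
      exact ((hρ.2 _ (mem_image_of_mem _ hγ) good.map_rectifiable).trans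
        (good.lineIntegral_map_le hg hρ.1)).trans (γ.lineIntegral_mono fun x => le_max_left _ _)
  calc ∫⁻ x, max (g x * ρ (f x)) (c * ρ₀ x) ^ Q ∂μ
      ≤ ∫⁻ x, ((g x * ρ (f x)) ^ Q + (c * ρ₀ x) ^ Q) ∂μ := by
        refine lintegral_mono fun x => ?_
        rcases max_choice (g x * ρ (f x)) (c * ρ₀ x) with h | h
        · rw [h]; exact le_self_add
        · rw [h]; exact le_add_self
    _ = ∫⁻ x, (g x * ρ (f x)) ^ Q ∂μ + ∫⁻ x, (c * ρ₀ x) ^ Q ∂μ :=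
        lintegral_add_left ((hg.mul hρf).pow_const Q) _
    _ ≤ K * ∫⁻ y, ρ y ^ Q ∂ν + ε := by
        refine add_le_add ?_ ((lintegral_const_mul_rpow hQ ct ρ₀).trans_le hc)
        calc ∫⁻ x, (g x * ρ (f x)) ^ Q ∂μ
            ≤ ∫⁻ x, K * (volumeDerivative μ ν f x * ρ (f x) ^ Q) ∂μ := by
              refine lintegral_mono_ae ?_
              filter_upwards [hgK] with x hx
              rw [ENNReal.mul_rpow_of_nonneg _ _ hQ.le, ← mul_assoc]
              gcongr
          _ = K * ∫⁻ x, volumeDerivative μ ν f x * ρ (f x) ^ Q ∂μ :=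
              lintegral_const_mul' _ _ ENNReal.coe_ne_top
          _ = K * ∫⁻ x, ρ (f x) ^ Q ∂μ.withDensity (volumeDerivative μ ν f) := by
              rw [lintegral_withDensity_eq_lintegral_mul _
                (show Measurable (volumeDerivative μ ν f) from Measure.measurable_rnDeriv _ _)
                (hρf.pow_const Q)]
              rfl
          _ ≤ K * ∫⁻ x, ρ (f x) ^ Q ∂ν.map f.symm := by
              gcongr
              -- The singular part is dropped; only this inequality is needed.
              exact Measure.withDensity_rnDeriv_le _ _
          _ = K * ∫⁻ y, ρ y ^ Q ∂ν := by
              rw [lintegral_map (hρf.pow_const Q) f.symm.continuous.measurable]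
              simp

end Geometric

/-! ### Quantitative strict convexity of the power function -/

section UniformConvexity

/-- Where `(1 - t) ^ Q ≥ η`, `t` stays away from `1`, and compactness bounds the midpoint convexity
gap below by some `m > 0`; then `C = 1 / m` works. This stands in for Clarkson's inequalities,
uniformly in `Q > 1`. -/
theorem exists_one_sub_rpow_le {Q η : ℝ} (hQ : 1 < Q) (hη : 0 < η) :
    ∃ C : ℝ, 0 ≤ C ∧ ∀ t ∈ Icc (0 : ℝ) 1,
      (1 - t) ^ Q + C * ((1 + t) / 2) ^ Q ≤ η + C * ((1 + t ^ Q) / 2) := by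
  have hQ0 : 0 ≤ Q := by linarith
  have c1 : Continuous fun t : ℝ => (1 - t) ^ Q :=
    (continuous_const.sub continuous_id).rpow_const fun _ => Or.inr hQ0
  have c2 : Continuous fun t : ℝ => (1 + t ^ Q) / 2 - ((1 + t) / 2) ^ Q :=
    ((continuous_const.add (continuous_id.rpow_const fun _ => Or.inr hQ0)).div_const 2).sub
      (((continuous_const.add continuous_id).div_const 2).rpow_const fun _ => Or.inr hQ0)
  have le_one : ∀ t ∈ Icc (0 : ℝ) 1, (1 - t) ^ Q ≤ 1 := fun t ht =>
    Real.rpow_le_one (by linarith [ht.2]) (by linarith [ht.1]) hQ0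
  have pos : ∀ t ∈ Ico (0 : ℝ) 1, 0 < (1 + t ^ Q) / 2 - ((1 + t) / 2) ^ Q := by
    intro t ht
    have := (strictConvexOn_rpow hQ).2 (show (1 : ℝ) ∈ Ici 0 by simp) (show t ∈ Ici 0 from ht.1)
      ht.2.ne' (show (0 : ℝ) < 1 / 2 by norm_num) (show (0 : ℝ) < 1 / 2 by norm_num) (by norm_num)
    simp only [smul_eq_mul, Real.one_rpow] at this
    rw [show (1 + t) / 2 = 1 / 2 * 1 + 1 / 2 * t by ring]
    linarith
  let S : Set ℝ := Icc 0 1 ∩ {t | η ≤ (1 - t) ^ Q}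
  have hS : IsCompact S := isCompact_Icc.inter_right (isClosed_le continuous_const c1)
  have nonneg : ∀ t ∈ Icc (0 : ℝ) 1, 0 ≤ (1 + t ^ Q) / 2 - ((1 + t) / 2) ^ Q := by
    intro t ht
    rcases ht.2.eq_or_lt with rfl | h
    · norm_num
    · exact (pos t ⟨ht.1, h⟩).le
  rcases S.eq_empty_or_nonempty with he | hne
  · refine ⟨0, le_rfl, fun t ht => ?_⟩
    have : ¬ η ≤ (1 - t) ^ Q := fun h => (he ▸ (⟨ht, h⟩ : t ∈ S) : t ∈ (∅ : Set ℝ))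
    simp only [zero_mul, add_zero]
    linarith
  · obtain ⟨s, hs, hmin⟩ := hS.exists_isMinOn hne c2.continuousOn
    have hs1 : s < 1 := by
      refine lt_of_le_of_ne hs.1.2 fun h => ?_
      have h2 : η ≤ (1 - s) ^ Q := hs.2
      rw [h, sub_self, Real.zero_rpow (by linarith)] at h2
      linarith
    set m := (1 + s ^ Q) / 2 - ((1 + s) / 2) ^ Q with hm
    have hm0 : 0 < m := pos s ⟨hs.1.1, hs1⟩
    refine ⟨1 / m, by positivity, fun t ht => ?_⟩
    suffices (1 - t) ^ Q ≤ η + 1 / m * ((1 + t ^ Q) / 2 - ((1 + t) / 2) ^ Q) by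
      rw [mul_sub] at this
      linarith
    by_cases h : η ≤ (1 - t) ^ Q
    · have h1 : m ≤ (1 + t ^ Q) / 2 - ((1 + t) / 2) ^ Q := hmin ⟨ht, h⟩
      have h2 : 1 ≤ 1 / m * ((1 + t ^ Q) / 2 - ((1 + t) / 2) ^ Q) := by
        rw [div_mul_eq_mul_div, one_mul, le_div_iff₀ hm0, one_mul]
        exact h1
      linarith [le_one t ht]
    · have : 0 ≤ 1 / m * ((1 + t ^ Q) / 2 - ((1 + t) / 2) ^ Q) :=
        mul_nonneg (by positivity) (nonneg t ht)
      linarith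

/-- Homogeneity: apply the previous inequality to `t = b / a`. -/
theorem exists_sub_rpow_le {Q η : ℝ} (hQ : 1 < Q) (hη : 0 < η) :
    ∃ C : ℝ, 0 ≤ C ∧ ∀ a b : ℝ, 0 ≤ a → 0 ≤ b →
      |a - b| ^ Q + C * ((a + b) / 2) ^ Q ≤ (η + C / 2) * (a ^ Q + b ^ Q) := by
  obtain ⟨C, hC, h⟩ := exists_one_sub_rpow_le hQ hη
  refine ⟨C, hC, fun a b ha hb => ?_⟩
  wlog hab : b ≤ a generalizing a b
  · rw [abs_sub_comm, add_comm a b, add_comm (a ^ Q)]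
    exact this b a hb ha (le_of_not_ge hab)
  rcases ha.eq_or_lt with rfl | ha'
  · obtain rfl : b = 0 := le_antisymm hab hb
    simp [Real.zero_rpow (by linarith : Q ≠ 0)]
  have ht : b / a ∈ Icc (0 : ℝ) 1 := ⟨by positivity, (div_le_one ha').2 hab⟩
  have key := mul_le_mul_of_nonneg_left (h _ ht) (Real.rpow_nonneg ha Q)
  have e1 : a ^ Q * (1 - b / a) ^ Q = |a - b| ^ Q := by
    rw [← Real.mul_rpow ha (by linarith [ht.2]), abs_of_nonneg (by linarith)]
    congr 1
    field_simp
  have e2 : a ^ Q * ((1 + b / a) / 2) ^ Q = ((a + b) / 2) ^ Q := by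
    rw [← Real.mul_rpow ha (by linarith [ht.1])]
    congr 1
    field_simp
  have e3 : a ^ Q * (b / a) ^ Q = b ^ Q := by
    rw [← Real.mul_rpow ha ht.1]
    congr 1
    field_simp
  have hb' : 0 ≤ b ^ Q := Real.rpow_nonneg hb Q
  calc |a - b| ^ Q + C * ((a + b) / 2) ^ Q
      = a ^ Q * ((1 - b / a) ^ Q + C * ((1 + b / a) / 2) ^ Q) := by rw [← e1, ← e2]; ring
    _ ≤ a ^ Q * (η + C * ((1 + (b / a) ^ Q) / 2)) := key
    _ = η * a ^ Q + C / 2 * (a ^ Q + b ^ Q) := by rw [← e3]; ring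
    _ ≤ (η + C / 2) * (a ^ Q + b ^ Q) := by nlinarith

/-- The subtraction is truncated: only the positive part of `a - b` is controlled, which suffices
for an upper envelope of a sequence. -/
theorem ennreal_exists_sub_rpow_le {Q : ℝ} {η : ℝ≥0} (hQ : 1 < Q) (hη : 0 < η) :
    ∃ C : ℝ≥0, ∀ a b : ℝ≥0∞,
      (a - b) ^ Q + C * (2⁻¹ * (a + b)) ^ Q ≤ (η + C / 2) * (a ^ Q + b ^ Q) := by
  have hQ0 : 0 < Q := by linarith
  obtain ⟨C, hC, h⟩ := exists_sub_rpow_le hQ (NNReal.coe_pos.2 hη)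
  lift C to ℝ≥0 using hC
  refine ⟨C, fun a b => ?_⟩
  have hne : (η : ℝ≥0∞) + C / 2 ≠ 0 := by
    simp [hη.ne']
  by_cases ha : a = ∞
  · refine le_top.trans_eq ?_
    rw [ha, ENNReal.top_rpow_of_pos hQ0, top_add, ENNReal.mul_top hne]
  by_cases hb : b = ∞
  · refine le_top.trans_eq ?_
    rw [hb, ENNReal.top_rpow_of_pos hQ0, add_top, ENNReal.mul_top hne]
  lift a to ℝ≥0 using ha
  lift b to ℝ≥0 using hb
  have key : (a - b) ^ Q + C * (2⁻¹ * (a + b)) ^ Q ≤ (η + C / 2) * (a ^ Q + b ^ Q) := by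
    rw [← NNReal.coe_le_coe]
    push_cast
    refine le_trans (add_le_add (Real.rpow_le_rpow (NNReal.coe_nonneg _) ?_ hQ0.le) (le_of_eq ?_))
      (h a b a.2 b.2)
    · rw [NNReal.coe_sub_def]
      exact max_le (le_abs_self _) (abs_nonneg _)
    · rw [div_eq_inv_mul]
  have e2 : (2⁻¹ : ℝ≥0∞) = ((2⁻¹ : ℝ≥0) : ℝ≥0∞) := by
    rw [ENNReal.coe_inv two_ne_zero]; rfl
  rw [div_eq_mul_inv, e2, ← ENNReal.coe_sub, ← ENNReal.coe_add, ← ENNReal.coe_mul,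
    ← ENNReal.coe_mul, ← ENNReal.coe_rpow_of_nonneg _ hQ0.le, ← ENNReal.coe_rpow_of_nonneg _ hQ0.le,
    ← ENNReal.coe_rpow_of_nonneg _ hQ0.le, ← ENNReal.coe_rpow_of_nonneg _ hQ0.le,
    ← ENNReal.coe_mul, ← ENNReal.coe_add, ← ENNReal.coe_add, ← ENNReal.coe_add, ← ENNReal.coe_mul,
    ENNReal.coe_le_coe, ← div_eq_mul_inv]
  exact key

end UniformConvexity

/-! ### Compactness for decreasing convex families in `L^Q` -/

section Mazur

variable {X : Type*} [MeasurableSpace X] {μ : Measure X} {Q : ℝ}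

/-- Almost minimizing elements of midpoint convex families with almost the same infimum are
close to each other in `L^Q`. -/
theorem exists_lintegral_sub_rpow_le (hQ : 1 < Q) {α ε : ℝ≥0∞} (hα : α ≠ ∞) (hε : ε ≠ 0) :
    ∃ τ : ℝ≥0∞, τ ≠ 0 ∧ ∀ a b : X → ℝ≥0∞, Measurable a → Measurable b →
      ∫⁻ x, a x ^ Q ∂μ ≤ α + τ → ∫⁻ x, b x ^ Q ∂μ ≤ α + τ →
      α ≤ ∫⁻ x, (2⁻¹ * (a x + b x)) ^ Q ∂μ + τ → ∫⁻ x, (a x - b x) ^ Q ∂μ ≤ ε := by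
  -- The budget `ε` is halved: `η` is chosen first, which fixes `C`, and then `τ` absorbs the term
  -- `2 C τ`. Capping `τ` by `1` bounds `α + τ` in advance.
  obtain ⟨η, hη0, hη⟩ : ∃ η : ℝ≥0, 0 < η ∧ η * (2 * (α + 1)) ≤ ε / 2 := by
    obtain ⟨c, c0, ct, hc⟩ := exists_scale one_pos (I := 2 * (α + 1)) (ε := ε / 2)
      (by finiteness) (ENNReal.div_ne_zero.2 ⟨hε, by simp⟩)
    lift c to ℝ≥0 using ct
    exact ⟨c, pos_iff_ne_zero.2 (by simpa using c0), by simpa using hc⟩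
  obtain ⟨C, hC⟩ := ennreal_exists_sub_rpow_le hQ hη0
  obtain ⟨τ, τ0, -, hτ⟩ := exists_scale one_pos (I := 2 * C) (ε := ε / 2)
    (by finiteness) (ENNReal.div_ne_zero.2 ⟨hε, by simp⟩)
  rw [ENNReal.rpow_one] at hτ
  refine ⟨min τ 1, (lt_min (pos_iff_ne_zero.2 τ0) one_pos).ne', fun a b ha hb ia ib im => ?_⟩
  set σ := min τ 1
  have hσ1 : σ ≤ 1 := min_le_right _ _
  have hστ : σ ≤ τ := min_le_left _ _
  have hm : Measurable fun x => (2⁻¹ * (a x + b x)) ^ Q := ((ha.add hb).const_mul _).pow_const Q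
  have hi := lintegral_mono (μ := μ) fun x => hC (a x) (b x)
  rw [lintegral_add_right _ (hm.const_mul _), lintegral_const_mul _ hm,
    lintegral_const_mul (f := fun x => a x ^ Q + b x ^ Q) _
      ((ha.pow_const Q).add (hb.pow_const Q)),
    lintegral_add_left (ha.pow_const Q)] at hi
  have hCα : (C : ℝ≥0∞) * α ≠ ∞ := by finiteness
  refine ENNReal.le_of_add_le_add_right hCα ?_
  calc ∫⁻ x, (a x - b x) ^ Q ∂μ + C * α
      ≤ ∫⁻ x, (a x - b x) ^ Q ∂μ + C * (∫⁻ x, (2⁻¹ * (a x + b x)) ^ Q ∂μ + σ) := by gcongr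
    _ = (∫⁻ x, (a x - b x) ^ Q ∂μ + C * ∫⁻ x, (2⁻¹ * (a x + b x)) ^ Q ∂μ) + C * σ := by ring
    _ ≤ (η + C / 2) * ((α + σ) + (α + σ)) + C * σ := by
        gcongr
        exact hi.trans (by gcongr)
    _ = η * (2 * (α + σ)) + C * (α + σ) + C * σ := by
        rw [← two_mul, add_mul, ← mul_assoc (C / 2 : ℝ≥0∞), ENNReal.div_mul_cancel (by simp) (by simp)]
    _ = η * (2 * (α + σ)) + σ * (2 * C) + C * α := by ring
    _ ≤ η * (2 * (α + 1)) + τ * (2 * C) + C * α := by gcongr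
    _ ≤ ε / 2 + ε / 2 + C * α := by gcongr
    _ = ε + C * α := by rw [ENNReal.add_halves]

/-- A decreasing sequence of midpoint convex, upward closed families of functions with bounded
`L^Q` infima has an element in its intersection. -/
theorem exists_forall_mem_lintegral_rpow_le (hQ : 1 < Q) {A : ℕ → Set (X → ℝ≥0∞)}
    (anti : Antitone A) (meas : ∀ n, ∀ h ∈ A n, Measurable h)
    (mid : ∀ n, ∀ g ∈ A n, ∀ h ∈ A n, (fun x => 2⁻¹ * (g x + h x)) ∈ A n)
    (up : ∀ n, ∀ g ∈ A n, ∀ h : X → ℝ≥0∞, Measurable h → (∀ x, g x ≤ h x) → h ∈ A n)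
    {M : ℝ≥0∞} (hM : M ≠ ∞) (bd : ∀ n, ∀ ε : ℝ≥0∞, ε ≠ 0 → ∃ h ∈ A n, ∫⁻ x, h x ^ Q ∂μ ≤ M + ε)
    {δ : ℝ≥0∞} (hδ : δ ≠ 0) :
    ∃ g : X → ℝ≥0∞, (∀ n, g ∈ A n) ∧ ∫⁻ x, g x ^ Q ∂μ ≤ M + δ := by
  have hQ0 : 0 < Q := by linarith
  let α : ℕ → ℝ≥0∞ := fun n => ⨅ h ∈ A n, ∫⁻ x, h x ^ Q ∂μ
  have αmono : Monotone α := fun i j hij => biInf_mono (anti hij)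
  have αM : ∀ n, α n ≤ M := fun n => le_of_forall_pos_le_add fun ε hε => by
    obtain ⟨h, hh, hi⟩ := bd n ε hε.ne'
    exact (iInf₂_le h hh).trans hi
  set β := ⨆ n, α n with hβ
  have βM : β ≤ M := iSup_le αM
  have βt : β ≠ ∞ := ne_top_of_le_ne_top hM βM
  -- The final function is `h 0 + S` with energies at most `M + r` and `r`; this `r` makes
  -- Minkowski's bound at most `M + δ`.
  obtain ⟨r, r0, hr⟩ : ∃ r : ℝ≥0∞, r ≠ 0 ∧ ((M + r) ^ (1 / Q) + r ^ (1 / Q)) ^ Q ≤ M + δ := by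
    have t : Tendsto (fun r : ℝ≥0∞ => ((M + r) ^ (1 / Q) + r ^ (1 / Q)) ^ Q) (𝓝 0) (𝓝 M) := by
      have c : Continuous fun r : ℝ≥0∞ => ((M + r) ^ (1 / Q) + r ^ (1 / Q)) ^ Q :=
        ENNReal.continuous_rpow_const.comp
          ((ENNReal.continuous_rpow_const.comp (continuous_const.add continuous_id)).add
            ENNReal.continuous_rpow_const)
      have := c.tendsto 0
      rwa [add_zero, ENNReal.zero_rpow_of_pos (by positivity), add_zero, ← ENNReal.rpow_mul,
        one_div_mul_cancel hQ0.ne', ENNReal.rpow_one] at this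
    have ev := (t.comp ENNReal.tendsto_inv_nat_nhds_zero).eventually
      (gt_mem_nhds (ENNReal.lt_add_right hM hδ))
    obtain ⟨n, hn⟩ := ev.exists
    exact ⟨(n : ℝ≥0∞)⁻¹, ENNReal.inv_ne_zero.2 (ENNReal.natCast_ne_top n), hn.le⟩
  obtain ⟨r', r'0, hr'⟩ := ENNReal.exists_pos_sum_of_countable r0 ℕ
  let c : ℕ → ℝ≥0∞ := fun k => 2 ^ (k + 1)
  have ct : ∀ k, c k ≠ ∞ := fun k => by simp [c]
  have cQt : ∀ k, c k ^ Q ≠ ∞ := fun k => ENNReal.rpow_ne_top_of_nonneg hQ0.le (ct k)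
  have cQ0 : ∀ k, c k ^ Q ≠ 0 := fun k =>
    (ENNReal.rpow_pos (pos_iff_ne_zero.2 (by simp [c])) (ct k)).ne'
  let B : ℕ → Set (X → ℝ≥0∞) := fun n => {h ∈ A n | ∫⁻ x, h x ^ Q ∂μ ≤ β + (n : ℝ≥0∞)⁻¹}
  have Banti : ∀ i j, i ≤ j → B j ⊆ B i := fun i j hij h hh =>
    ⟨anti hij hh.1, hh.2.trans (add_le_add_right
      (ENNReal.inv_le_inv.2 (Nat.cast_le.2 hij)) β)⟩
  have Bne : ∀ n, (B n).Nonempty := fun n => by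
    have : α n < β + (n : ℝ≥0∞)⁻¹ := (le_iSup α n).trans_lt (ENNReal.lt_add_right βt
      (ENNReal.inv_ne_zero.2 (ENNReal.natCast_ne_top n)))
    obtain ⟨h, hh⟩ := iInf_lt_iff.1 this
    obtain ⟨hA, hh⟩ := iInf_lt_iff.1 hh
    exact ⟨h, hA, hh.le⟩
  have inv_le : ∀ τ : ℝ≥0∞, τ ≠ 0 → ∀ᶠ n : ℕ in atTop, (n : ℝ≥0∞)⁻¹ ≤ τ := fun τ hτ =>
    (ENNReal.tendsto_inv_nat_nhds_zero.eventually (gt_mem_nhds (pos_iff_ne_zero.2 hτ))).mono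
      fun _ h => h.le
  -- Midpoints of elements of `B n` stay in `A n`, so their energy is at least `α n`, which is close
  -- to `β`.
  have close : ∀ ε : ℝ≥0∞, ε ≠ 0 → ∀ᶠ n in atTop, ∀ a ∈ B n, ∀ b ∈ B n,
      ∫⁻ x, (a x - b x) ^ Q ∂μ ≤ ε := by
    intro ε hε
    obtain ⟨τ, τ0, hτ⟩ := exists_lintegral_sub_rpow_le (μ := μ) hQ βt hε
    have ev : ∀ᶠ n in atTop, β ≤ α n + τ := by
      have t : Tendsto (fun n => α n + τ) atTop (𝓝 (β + τ)) :=
        (tendsto_atTop_iSup αmono).add_const τ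
      exact (t.eventually (lt_mem_nhds (ENNReal.lt_add_right βt τ0))).mono fun _ h => h.le
    filter_upwards [ev, inv_le τ τ0] with n h1 h2 a ha b hb
    exact hτ a b (meas n a ha.1) (meas n b hb.1) (ha.2.trans (by gcongr)) (hb.2.trans (by gcongr))
      (h1.trans (add_le_add_left (iInf₂_le (fun x => 2⁻¹ * (a x + b x)) (mid n a ha.1 b hb.1)) τ))
  obtain ⟨φ, hφ, hP⟩ := extraction_forall_of_eventually (P := fun k n =>
      (∀ a ∈ B n, ∀ b ∈ B n, ∫⁻ x, (a x - b x) ^ Q ∂μ ≤ r' k / c k ^ Q) ∧ (n : ℝ≥0∞)⁻¹ ≤ r)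
    fun k => (close _ (ENNReal.div_ne_zero.2
      ⟨ENNReal.coe_ne_zero.2 (r'0 k).ne', cQt k⟩)).and (inv_le r r0)
  choose h hB using fun k => Bne (φ k)
  have hm : ∀ k, Measurable (h k) := fun k => meas _ _ (hB k).1
  -- Each upward increment is at most `2^{-(k+1)} S`, so `h 0 + S` lies above every `h k`. Upward
  -- closure then puts it in every `A n`, with no limit taken.
  let S : X → ℝ≥0∞ := fun x => ⨆ k, c k * (h (k + 1) x - h k x)
  have hSm : ∀ k, Measurable fun x => c k * (h (k + 1) x - h k x) := fun k =>
    ((hm _).sub (hm _)).const_mul _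
  have Sm : Measurable S := .iSup hSm
  have Si : ∫⁻ x, S x ^ Q ∂μ ≤ r := by
    refine (lintegral_iSup_rpow_le hQ0 hSm).trans (le_trans ?_ hr'.le)
    refine ENNReal.tsum_le_tsum fun k => ?_
    rw [lintegral_const_mul_rpow hQ0 (ct k)]
    calc c k ^ Q * ∫⁻ x, (h (k + 1) x - h k x) ^ Q ∂μ ≤ c k ^ Q * (r' k / c k ^ Q) := by
          gcongr
          exact (hP k).1 _ (Banti _ _ (hφ.monotone k.le_succ) (hB (k + 1))) _ (hB k)
      _ = r' k := ENNReal.mul_div_cancel (cQ0 k) (cQt k)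
  have hle : ∀ k x, h k x + 2⁻¹ ^ k * S x ≤ h 0 x + S x := by
    intro k x
    induction k with
    | zero => simp
    | succ k ih =>
      refine le_trans ?_ ih
      have e1 : (2⁻¹ : ℝ≥0∞) ^ (k + 1) * c k = 1 := by
        rw [← mul_pow, ENNReal.inv_mul_cancel (by simp) (by simp), one_pow]
      have e2 : (2⁻¹ : ℝ≥0∞) ^ (k + 1) + 2⁻¹ ^ (k + 1) = 2⁻¹ ^ k := by
        rw [pow_succ, ← mul_add, ENNReal.inv_two_add_inv_two, mul_one]
      have e3 : h (k + 1) x - h k x ≤ 2⁻¹ ^ (k + 1) * S x := by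
        calc h (k + 1) x - h k x = 2⁻¹ ^ (k + 1) * (c k * (h (k + 1) x - h k x)) := by
              rw [← mul_assoc, e1, one_mul]
          _ ≤ _ := by gcongr; exact le_iSup (fun k => c k * (h (k + 1) x - h k x)) k
      calc h (k + 1) x + 2⁻¹ ^ (k + 1) * S x
          ≤ (h k x + (h (k + 1) x - h k x)) + 2⁻¹ ^ (k + 1) * S x := by
            gcongr
            exact le_add_tsub
        _ ≤ (h k x + 2⁻¹ ^ (k + 1) * S x) + 2⁻¹ ^ (k + 1) * S x := by gcongr
        _ = h k x + 2⁻¹ ^ k * S x := by rw [← e2]; ring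
  refine ⟨fun x => h 0 x + S x, fun n => ?_, ?_⟩
  · exact up n _ (anti (hφ.id_le n) (hB n).1) _ ((hm 0).add Sm) fun x =>
      le_self_add.trans (hle n x)
  · have mink := ENNReal.lintegral_Lp_add_le (μ := μ) (hm 0).aemeasurable Sm.aemeasurable hQ.le
    refine le_trans ?_ hr
    calc ∫⁻ x, (h 0 x + S x) ^ Q ∂μ = ((∫⁻ x, (h 0 x + S x) ^ Q ∂μ) ^ (1 / Q)) ^ Q := by
          rw [one_div, ENNReal.rpow_inv_rpow hQ0.ne']
      _ ≤ ((M + r) ^ (1 / Q) + r ^ (1 / Q)) ^ Q := by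
          refine ENNReal.rpow_le_rpow (mink.trans (add_le_add ?_ ?_)) hQ0.le
          · exact ENNReal.rpow_le_rpow ((hB 0).2.trans (add_le_add βM (hP 0).2)) (by positivity)
          · exact ENNReal.rpow_le_rpow Si (by positivity)

end Mazur

/-! ### Upper gradients on open sets from the geometric condition -/

section Local

variable {X Y : Type*} [MetricSpace X] [MeasurableSpace X] [BorelSpace X]
  [MetricSpace Y] {μ : Measure X} {Q : ℝ}

theorem Curve.Rectifiable.lineIntegral_sub_add_le {γ : Curve X} (hγ : γ.Rectifiable) {t : ℝ}
    (h₁ : γ.a ≤ t) (h₂ : t ≤ γ.b) {ρ : X → ℝ≥0∞} (hρ : Measurable ρ) :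
    (γ.sub γ.a t h₁).lineIntegral ρ + (γ.sub t γ.b h₂).lineIntegral ρ ≤ γ.lineIntegral ρ := by
  have := hγ.nullSingleton
  rw [hγ.lineIntegral_sub h₁ hρ, hγ.lineIntegral_sub h₂ hρ, hγ.lineIntegral_eq hρ,
    ← setLIntegral_congr Ioc_ae_eq_Icc, ← setLIntegral_congr Ioc_ae_eq_Icc,
    ← lintegral_union measurableSet_Ioc
      (disjoint_left.2 fun x hx hx' => absurd hx'.1 (not_lt.2 hx.2))]
  exact setLIntegral_le_lintegral _ _

theorem Curve.range_sub_subset {X : Type*} [TopologicalSpace X] (γ : Curve X) {c d : ℝ}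
    (h : c ≤ d) : range (γ.sub c d h).toMap ⊆ range γ.toMap := by
  rintro _ ⟨t, rfl⟩
  exact γ.extend_mem_range t

/-- If each curve in `V` whose image has end points at distance at least `r` has `ρ`-length at
least one, then the `ρ`-length controls the distance of the end points of all image curves. -/
theorem natCast_le_lineIntegral {f : C(X, Y)} {V : Set X} {r : ℝ} (hr : 0 < r) {ρ : X → ℝ≥0∞}
    (hρ : Measurable ρ)
    (h : ∀ γ : Curve X, γ.Rectifiable → range γ.toMap ⊆ V →
      r ≤ dist (f γ.source) (f γ.target) → 1 ≤ γ.lineIntegral ρ) (N : ℕ) :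
    ∀ γ : Curve X, γ.Rectifiable → range γ.toMap ⊆ V →
      N * r ≤ dist (f γ.source) (f γ.target) → N ≤ γ.lineIntegral ρ := by
  induction N with
  | zero => intro γ _ _ _; simp
  | succ N ih =>
    intro γ hγ hV hd
    push_cast at hd
    have hc : Continuous fun t => dist (f (γ.extend t)) (f γ.target) :=
      (f.continuous.comp γ.continuous_extend).dist continuous_const
    have hN : (0 : ℝ) ≤ N * r := by positivity
    -- Cut where the distance to the end point is exactly `N * r`; the first piece then spans at
    -- least `r` by the triangle inequality.
    obtain ⟨t, ht, hdt⟩ := intermediate_value_Icc' γ.le hc.continuousOn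
      (show (N : ℝ) * r ∈ Icc _ _ by
        rw [γ.extend_a, γ.extend_b, dist_self]
        exact ⟨hN, by linarith⟩)
    refine le_trans ?_ (hγ.lineIntegral_sub_add_le ht.1 ht.2 hρ)
    rw [Nat.cast_succ, add_comm]
    refine add_le_add (h _ (hγ.sub _) ((γ.range_sub_subset _).trans hV) ?_)
      (ih _ (hγ.sub _) ((γ.range_sub_subset _).trans hV) ?_)
    · rw [γ.sub_source, γ.sub_target, γ.extend_a]
      have := dist_triangle (f γ.source) (f (γ.extend t)) (f γ.target)
      dsimp only at hdt
      linarith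
    · rw [γ.sub_source, γ.sub_target, γ.extend_b]
      exact hdt.ge

/-- Subdivide with `r = 1 / n` and `N = ⌊n · dist⌋`; rounding down loses at most `1 / n`. -/
theorem edist_le_lineIntegral_add {f : C(X, Y)} {V : Set X} {n : ℕ} (hn : n ≠ 0) {ρ : X → ℝ≥0∞}
    (hρ : Measurable ρ)
    (h : ∀ γ : Curve X, γ.Rectifiable → range γ.toMap ⊆ V →
      (n : ℝ≥0∞)⁻¹ ≤ edist (f γ.source) (f γ.target) → 1 ≤ γ.lineIntegral ρ)
    {γ : Curve X} (hγ : γ.Rectifiable) (hV : range γ.toMap ⊆ V) :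
    edist (f γ.source) (f γ.target) ≤
      γ.lineIntegral (fun x => (n : ℝ≥0∞)⁻¹ * ρ x) + (n : ℝ≥0∞)⁻¹ := by
  have hn' : (0 : ℝ) < n := Nat.cast_pos.2 (Nat.pos_of_ne_zero hn)
  have inv_eq : ENNReal.ofReal ((n : ℝ)⁻¹) = (n : ℝ≥0∞)⁻¹ := by
    rw [ENNReal.ofReal_inv_of_pos hn', ENNReal.ofReal_natCast]
  have key := natCast_le_lineIntegral (f := f) (V := V) (inv_pos.2 hn') hρ (fun γ hγ hV hd =>
    h γ hγ hV (by rw [edist_dist, ← inv_eq]; exact ENNReal.ofReal_le_ofReal hd))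
    ⌊dist (f γ.source) (f γ.target) * n⌋₊ γ hγ hV (by
      rw [← div_eq_mul_inv, div_le_iff₀ hn']
      exact Nat.floor_le (by positivity))
  set N := ⌊dist (f γ.source) (f γ.target) * n⌋₊
  have lt : dist (f γ.source) (f γ.target) * n < N + 1 := Nat.lt_floor_add_one _
  have le : dist (f γ.source) (f γ.target) ≤ (n : ℝ)⁻¹ * N + (n : ℝ)⁻¹ := by
    rw [← lt_div_iff₀ hn', add_div] at lt
    rw [inv_mul_eq_div, ← one_div]
    exact lt.le
  have inv_ne : (n : ℝ≥0∞)⁻¹ ≠ ∞ := ENNReal.inv_ne_top.2 (Nat.cast_ne_zero.2 hn)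
  rw [γ.lineIntegral_const_mul inv_ne]
  calc edist (f γ.source) (f γ.target) ≤ ENNReal.ofReal ((n : ℝ)⁻¹ * N + (n : ℝ)⁻¹) := by
        rw [edist_dist]
        exact ENNReal.ofReal_le_ofReal le
    _ = (n : ℝ≥0∞)⁻¹ * N + (n : ℝ≥0∞)⁻¹ := by
        rw [ENNReal.ofReal_add (by positivity) (by positivity),
          ENNReal.ofReal_mul (by positivity), inv_eq, ENNReal.ofReal_natCast]
    _ ≤ _ := by gcongr

/-- The functions that are upper gradients of `f` up to an error `e` along curves in `V`. -/
def approxUpperGradients (f : C(X, Y)) (V : Set X) (e : ℝ≥0∞) : Set (X → ℝ≥0∞) :=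
  {h | Measurable h ∧ ∀ γ : Curve X, γ.Rectifiable → range γ.toMap ⊆ V →
    edist (f γ.source) (f γ.target) ≤ γ.lineIntegral h + e}

theorem midpoint_mem_approxUpperGradients {f : C(X, Y)} {V : Set X} {e : ℝ≥0∞}
    {g h : X → ℝ≥0∞} (hg : g ∈ approxUpperGradients f V e) (hh : h ∈ approxUpperGradients f V e) :
    (fun x => 2⁻¹ * (g x + h x)) ∈ approxUpperGradients f V e := by
  have i2 : (2⁻¹ : ℝ≥0∞) ≠ ∞ := by simp
  have half : ∀ a : ℝ≥0∞, 2⁻¹ * (a + a) = a := fun a => by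
    rw [← two_mul, ← mul_assoc, ENNReal.inv_mul_cancel (by simp) (by simp), one_mul]
  refine ⟨(hg.1.add hh.1).const_mul _, fun γ hγ hV => ?_⟩
  have e1 : γ.lineIntegral (fun x => g x + h x) = γ.lineIntegral g + γ.lineIntegral h := by
    rw [hγ.lineIntegral_eq hg.1, hγ.lineIntegral_eq hh.1,
      hγ.lineIntegral_eq (ρ := fun x => g x + h x) (hg.1.add hh.1),
      lintegral_add_left (measurable_comp_extend hg.1 γ)]
  rw [γ.lineIntegral_const_mul i2, e1]
  calc edist (f γ.source) (f γ.target)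
      = 2⁻¹ * (edist (f γ.source) (f γ.target) + edist (f γ.source) (f γ.target)) := (half _).symm
    _ ≤ 2⁻¹ * ((γ.lineIntegral g + e) + (γ.lineIntegral h + e)) := by
        gcongr
        exacts [hg.2 γ hγ hV, hh.2 γ hγ hV]
    _ = 2⁻¹ * (γ.lineIntegral g + γ.lineIntegral h) + 2⁻¹ * (e + e) := by ring
    _ = _ := by rw [half]

variable [MeasurableSpace Y] [BorelSpace Y] {ν : Measure Y}

theorem GeometricCondition.exists_approxUpperGradient (hQ : 0 < Q) {K : ℝ≥0} {f : X ≃ₜ Y}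
    (hG : GeometricCondition Q K μ ν f) {V : Set X} (hV : IsOpen V) (hfin : ν (f '' V) ≠ ∞)
    (n : ℕ) {ε : ℝ≥0∞} (hε : ε ≠ 0) :
    ∃ h ∈ approxUpperGradients (f : C(X, Y)) V (n : ℝ≥0∞)⁻¹,
      ∫⁻ x, h x ^ Q ∂μ ≤ K * ν (f '' V) + ε := by
  -- For `n = 0` the allowed error is `0⁻¹ = ∞`, so the zero function works.
  rcases eq_or_ne n 0 with rfl | hn
  · exact ⟨0, ⟨measurable_zero, fun γ _ _ => by simp⟩, by simp [hQ]⟩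
  have fV : MeasurableSet (f '' V) := (f.isOpenMap V hV).measurableSet
  have n0 : (n : ℝ≥0∞) ≠ 0 := Nat.cast_ne_zero.2 hn
  have nt : (n : ℝ≥0∞) ≠ ∞ := ENNReal.natCast_ne_top n
  have nQ0 : (n : ℝ≥0∞) ^ Q ≠ 0 := (ENNReal.rpow_pos (pos_iff_ne_zero.2 n0) nt).ne'
  have nQt : (n : ℝ≥0∞) ^ Q ≠ ∞ := ENNReal.rpow_ne_top_of_nonneg hQ.le nt
  let Γ : Set (Curve X) := {γ | γ.Rectifiable ∧ range γ.toMap ⊆ V ∧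
    (n : ℝ≥0∞)⁻¹ ≤ edist (f γ.source) (f γ.target)}
  have mod : modulus Q ν (Curve.map (f : C(X, Y)) '' Γ) ≤ n ^ Q * ν (f '' V) := by
    -- An image curve stays in `f '' V` and has length at least `1 / n`.
    have adm : Admissible (fun y => n * (f '' V).indicator 1 y)
        (Curve.map (f : C(X, Y)) '' Γ) := by
      refine ⟨(measurable_one.indicator fV).const_mul _, ?_⟩
      rintro _ ⟨γ, hγ, rfl⟩ hr
      rw [Curve.lineIntegral_const_mul _ nt,
        hr.lineIntegral_eq (measurable_one.indicator fV)]
      have one : ∀ t, (f '' V).indicator (1 : Y → ℝ≥0∞) ((γ.map (f : C(X, Y))).extend t) = 1 :=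
        fun t => indicator_of_mem
          (mem_image_of_mem f (hγ.2.1 (γ.extend_mem_range t))) _
      simp_rw [one]
      rw [lintegral_one]
      calc (1 : ℝ≥0∞) = n * (n : ℝ≥0∞)⁻¹ := (ENNReal.mul_inv_cancel n0 nt).symm
        _ ≤ n * edist (f γ.source) (f γ.target) := by gcongr; exact hγ.2.2
        _ ≤ n * (γ.map (f : C(X, Y))).arcMeasure (Icc γ.a γ.b) := by
            gcongr
            rw [hr.arcMeasure_Icc γ.le, ← γ.extend_a, ← γ.extend_b]
            exact eVariationOn.edist_le (γ.map (f : C(X, Y))).extend (left_mem_Icc.2 γ.le)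
              (right_mem_Icc.2 γ.le)
        _ ≤ _ := by gcongr; exact subset_univ _
    refine (modulus_le adm).trans_eq ?_
    rw [lintegral_const_mul_rpow hQ nt]
    congr 1
    rw [← lintegral_indicator_one fV]
    refine lintegral_congr fun y => ?_
    by_cases hy : y ∈ f '' V
    · simp only [indicator_of_mem hy, Pi.one_apply, ENNReal.one_rpow]
    · simp only [indicator_of_notMem hy, ENNReal.zero_rpow_of_pos hQ]
  have lt : modulus Q μ Γ < n ^ Q * (K * ν (f '' V) + ε) := by
    calc modulus Q μ Γ ≤ K * modulus Q ν (Curve.map (f : C(X, Y)) '' Γ) := hG Γ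
      _ ≤ K * (n ^ Q * ν (f '' V)) := by gcongr
      _ = n ^ Q * (K * ν (f '' V)) := by ring
      _ < n ^ Q * (K * ν (f '' V) + ε) :=
        (ENNReal.mul_lt_mul_iff_right nQ0 nQt).2
          (ENNReal.lt_add_right (ENNReal.mul_ne_top ENNReal.coe_ne_top hfin) hε)
  obtain ⟨ρ, hρ⟩ := iInf_lt_iff.1 lt
  obtain ⟨ha, hρ⟩ := iInf_lt_iff.1 hρ
  refine ⟨fun x => (n : ℝ≥0∞)⁻¹ * ρ x, ⟨ha.1.const_mul _, fun γ hγ hγV => ?_⟩, ?_⟩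
  · exact edist_le_lineIntegral_add (f := (f : C(X, Y))) hn ha.1
      (fun γ h1 h2 h3 => ha.2 γ ⟨h1, h2, h3⟩ h1) hγ hγV
  · rw [lintegral_const_mul_rpow hQ (ENNReal.inv_ne_top.2 n0), ENNReal.inv_rpow]
    calc ((n : ℝ≥0∞) ^ Q)⁻¹ * ∫⁻ x, ρ x ^ Q ∂μ
        ≤ ((n : ℝ≥0∞) ^ Q)⁻¹ * (n ^ Q * (K * ν (f '' V) + ε)) := by gcongr
      _ = _ := by rw [← mul_assoc, ENNReal.inv_mul_cancel nQ0 nQt, one_mul]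

/-- The geometric condition yields an upper gradient along the curves in an open set, with the
expected energy. -/
theorem GeometricCondition.exists_upperGradient_on (hQ : 1 < Q) {K : ℝ≥0} {f : X ≃ₜ Y}
    (hG : GeometricCondition Q K μ ν f) {V : Set X} (hV : IsOpen V) (hfin : ν (f '' V) ≠ ∞)
    {δ : ℝ≥0∞} (hδ : δ ≠ 0) :
    ∃ g : X → ℝ≥0∞, Measurable g ∧ ∫⁻ x, g x ^ Q ∂μ ≤ K * ν (f '' V) + δ ∧
      ∀ γ : Curve X, γ.Rectifiable → range γ.toMap ⊆ V →
        edist (f γ.source) (f γ.target) ≤ γ.lineIntegral g := by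
  obtain ⟨g, hg, hi⟩ := exists_forall_mem_lintegral_rpow_le (μ := μ) hQ
    (A := fun n : ℕ => approxUpperGradients (f : C(X, Y)) V (n : ℝ≥0∞)⁻¹)
    (fun i j hij h hh => ⟨hh.1, fun γ h1 h2 => (hh.2 γ h1 h2).trans (by gcongr)⟩)
    (fun n h hh => hh.1) (fun n g hg h hh => midpoint_mem_approxUpperGradients hg hh)
    (fun n g hg h hm hgh => ⟨hm, fun γ h1 h2 => (hg.2 γ h1 h2).trans
      (add_le_add_left (γ.lineIntegral_mono hgh) _)⟩)
    (ENNReal.mul_ne_top ENNReal.coe_ne_top hfin)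
    (fun n ε hε => hG.exists_approxUpperGradient (by linarith) hV hfin n hε) hδ
  refine ⟨g, (hg 0).1, hi, fun γ h1 h2 => ?_⟩
  have t := ENNReal.tendsto_inv_nat_nhds_zero.const_add (γ.lineIntegral g)
  rw [add_zero] at t
  exact ge_of_tendsto' t fun n => (hg n).2 γ h1 h2

end Local

/-! ### Globalization and the pointwise bound -/

section Main

variable {X Y : Type*} [MetricSpace X] [MeasurableSpace X] [BorelSpace X]
  [MetricSpace Y] {μ : Measure X} {Q : ℝ}

/-- A fine partition puts each piece of the curve in one `V i`; half-open pieces avoid double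
counting when the integrals are added. -/
theorem edist_le_lineIntegral_of_cover {ι : Type*} {f : C(X, Y)} {g : X → ℝ≥0∞}
    (hg : Measurable g) {V : ι → Set X} (hV : ∀ i, IsOpen (V i)) (hcov : ⋃ i, V i = univ)
    (h : ∀ i, ∀ γ : Curve X, γ.Rectifiable → range γ.toMap ⊆ V i →
      edist (f γ.source) (f γ.target) ≤ γ.lineIntegral g) {γ : Curve X} (hγ : γ.Rectifiable) :
    edist (f γ.source) (f γ.target) ≤ γ.lineIntegral g := by
  have := hγ.nullSingleton
  obtain ⟨t, t0, tmono, ⟨m, hm⟩, ht⟩ := exists_monotone_Icc_subset_open_cover_Icc γ.le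
    (c := fun i => γ.toMap ⁻¹' V i) (fun i => (hV i).preimage γ.toMap.continuous)
    (fun x _ => by
      have : γ.toMap x ∈ ⋃ i, V i := hcov ▸ mem_univ _
      simpa using this)
  have step : ∀ n, edist (f (γ.extend (t n))) (f (γ.extend (t (n + 1)))) ≤
      ∫⁻ s in Ioc (t n : ℝ) (t (n + 1)), g (γ.extend s) ∂γ.arcMeasure := by
    intro n
    obtain ⟨i, hi⟩ := ht n
    have hle : (t n : ℝ) ≤ t (n + 1) := tmono n.le_succ
    rw [setLIntegral_congr Ioc_ae_eq_Icc, ← hγ.lineIntegral_sub hle hg]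
    refine h i _ (hγ.sub hle) ?_
    rintro _ ⟨s, rfl⟩
    have hs : (s : ℝ) ∈ Icc γ.a γ.b := ⟨(t n).2.1.trans s.2.1, s.2.2.trans (t (n + 1)).2.2⟩
    have : γ.toMap ⟨s, hs⟩ ∈ V i := hi (show (⟨s, hs⟩ : Icc γ.a γ.b) ∈ Icc (t n) (t (n + 1)) from
      ⟨s.2.1, s.2.2⟩)
    rwa [← IccExtend_of_mem γ.le γ.toMap hs] at this
  have chain : ∀ n, edist (f (γ.extend (t 0))) (f (γ.extend (t n))) ≤
      ∫⁻ s in Ioc (t 0 : ℝ) (t n), g (γ.extend s) ∂γ.arcMeasure := by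
    intro n
    induction n with
    | zero => simp
    | succ n ih =>
      rw [← Ioc_union_Ioc_eq_Ioc (show (t 0 : ℝ) ≤ t n from tmono n.zero_le)
        (show (t n : ℝ) ≤ t (n + 1) from tmono n.le_succ), lintegral_union measurableSet_Ioc
        (disjoint_left.2 fun x hx hx' => absurd hx'.1 (not_lt.2 hx.2))]
      exact (edist_triangle _ _ _).trans (add_le_add ih (step n))
  have := chain m
  rw [t0, hm m le_rfl] at this
  rw [hγ.lineIntegral_eq hg, ← γ.extend_a, ← γ.extend_b]
  exact this.trans (setLIntegral_le_lintegral _ _)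

variable [MeasurableSpace Y] [BorelSpace Y] {ν : Measure Y}

omit [MeasurableSpace X] [BorelSpace X] [BorelSpace Y] in
theorem exists_countable_cover [SecondCountableTopology X] [IsLocallyFiniteMeasure ν]
    (f : X ≃ₜ Y) :
    ∃ V : ℕ → Set X, (∀ n, IsOpen (V n)) ∧ ⋃ n, V n = univ ∧ LocallyFinite V ∧
      ∀ n, ν (f '' V n) ≠ ∞ := by
  rcases isEmpty_or_nonempty X with hX | hX
  · exact ⟨fun _ => ∅, fun _ => isOpen_empty, by simp [eq_iff_true_of_subsingleton],
      fun x => isEmptyElim x, by simp⟩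
  have ex : ∀ x, ∃ U : Set X, IsOpen U ∧ x ∈ U ∧ ν (f '' U) < ∞ := fun x => by
    obtain ⟨W, hxW, hW, hfin⟩ := ν.exists_isOpen_measure_lt_top (f x)
    exact ⟨f ⁻¹' W, hW.preimage f.continuous, hxW, by rwa [f.image_preimage]⟩
  choose U hU hxU hfin using ex
  obtain ⟨e, hcov⟩ := exists_seq_cover_nhds fun x => (hU x).mem_nhds (hxU x)
  obtain ⟨V, hVo, hVc, hVl, hVU⟩ := precise_refinement (fun n => U (e n)) (fun n => hU _) hcov
  exact ⟨V, hVo, hVc, hVl, fun n => ((measure_mono (image_mono (hVU n))).trans_lt (hfin _)).ne⟩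

/-- The supremum of the local gradients, each cut off to its `V n`, dominates all of them there.
Local finiteness of the cover leaves finitely many near each point, so no smallness of their
energies is needed. -/
theorem GeometricCondition.exists_upperGradient [SecondCountableTopology X]
    [IsLocallyFiniteMeasure ν] (hQ : 1 < Q) {K : ℝ≥0} {f : X ≃ₜ Y}
    (hG : GeometricCondition Q K μ ν f) :
    ∃ g : X → ℝ≥0∞, IsUpperGradient g f ∧ LocIntegrablePow Q μ g := by
  have hQ0 : 0 < Q := by linarith
  obtain ⟨V, hV, hcov, hloc, hfin⟩ := exists_countable_cover (ν := ν) f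
  choose g hg hi hgV using fun n => hG.exists_upperGradient_on hQ (hV n) (hfin n) one_ne_zero
  have hm : ∀ n, Measurable ((V n).indicator (g n)) := fun n =>
    (hg n).indicator (hV n).measurableSet
  have hm' : Measurable fun x => ⨆ n, (V n).indicator (g n) x := .iSup hm
  refine ⟨fun x => ⨆ n, (V n).indicator (g n) x, ⟨hm', fun γ hγ => ?_⟩, fun x => ?_⟩
  · refine edist_le_lineIntegral_of_cover (f := (f : C(X, Y))) hm' hV hcov
      (fun n γ hγ hr => (hgV n γ hγ hr).trans ?_) hγ
    rw [hγ.lineIntegral_eq (hg n), hγ.lineIntegral_eq hm']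
    refine lintegral_mono fun t => ?_
    rw [← indicator_of_mem (hr (γ.extend_mem_range t)) (g n)]
    exact le_iSup (fun n => (V n).indicator (g n) (γ.extend t)) n
  · obtain ⟨W, hW, hfinW⟩ := hloc x
    obtain ⟨U, hUW, hU, hxU⟩ := mem_nhds_iff.1 hW
    refine ⟨U, hU, hxU, (lintegral_iSup_rpow_le hQ0 hm).trans_lt ?_⟩
    rw [tsum_eq_sum (s := hfinW.toFinset)]
    · refine ENNReal.sum_lt_top.2 fun n _ => ?_
      refine lt_of_le_of_lt ?_ (lt_top_iff_ne_top.2 (ENNReal.add_ne_top.2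
        ⟨ENNReal.mul_ne_top (ENNReal.coe_ne_top (r := K)) (hfin n), ENNReal.one_ne_top⟩))
      refine (setLIntegral_le_lintegral _ _).trans (le_trans (lintegral_mono fun y => ?_) (hi n))
      exact ENNReal.rpow_le_rpow (indicator_le_self _ _ _) hQ0.le
    · intro n hn
      have hn' : ¬ (V n ∩ W).Nonempty := fun h => hn (hfinW.mem_toFinset.2 h)
      refine le_antisymm ((setLIntegral_mono' (g := 0) hU.measurableSet
        fun y hy => ?_).trans (by simp)) zero_le
      have : y ∉ V n := fun h => hn' ⟨y, h, hUW hy⟩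
      simp [this, hQ0]

theorem memLpLoc_of_continuous [IsLocallyFiniteMeasure μ] (hQ : 0 < Q) {f : X → Y}
    (hf : Continuous f) : MemLpLoc Q μ f := by
  refine ⟨hf.measurable, fun x => ?_⟩
  obtain ⟨W, hxW, hW, hfin⟩ := μ.exists_isOpen_measure_lt_top x
  refine ⟨f x, W ∩ f ⁻¹' Metric.eball (f x) 1, hW.inter (Metric.isOpen_eball.preimage hf),
    ⟨hxW, Metric.mem_eball_self one_pos⟩, ?_⟩
  refine lt_of_le_of_lt (b := μ (W ∩ f ⁻¹' Metric.eball (f x) 1)) ?_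
    ((measure_mono inter_subset_left).trans_lt hfin)
  rw [← setLIntegral_one]
  refine setLIntegral_mono measurable_const fun y hy => ?_
  have : edist (f y) (f x) < 1 := hy.2
  rw [edist_comm]
  exact ENNReal.rpow_le_one this.le hQ.le

/-- Replacing `g` on `V` by the gradient `h` of energy at most `K ν (f '' V) + δ` gives a
competitor, so minimality forces `g ≤ h` a.e. on `V`. -/
theorem GeometricCondition.setLIntegral_minimal_le [SecondCountableTopology X]
    (hQ : 1 < Q) {K : ℝ≥0} {f : X ≃ₜ Y} (hG : GeometricCondition Q K μ ν f) {g : X → ℝ≥0∞}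
    (hg : IsMinimalWeakUpperGradient Q μ g f) {V : Set X} (hV : IsOpen V)
    (hfin : ν (f '' V) ≠ ∞) : ∫⁻ x in V, g x ^ Q ∂μ ≤ K * ν (f '' V) := by
  classical
  have hQ0 : 0 < Q := by linarith
  obtain ⟨hw, hl, hmin⟩ := hg
  refine le_of_forall_pos_le_add fun δ hδ => ?_
  wlog hδt : δ ≠ ∞ generalizing δ
  · rw [not_not.1 hδt, add_top]; exact le_top
  obtain ⟨h, hh, hi, hup⟩ := hG.exists_upperGradient_on hQ hV hfin hδ.ne'
  have hit : ∫⁻ x, h x ^ Q ∂μ < ∞ := hi.trans_lt (lt_top_iff_ne_top.2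
    (ENNReal.add_ne_top.2 ⟨ENNReal.mul_ne_top ENNReal.coe_ne_top hfin, hδt⟩))
  have hgood := IsWeakUpperGradient.isGood (f := (f : C(X, Y))) hQ0 hw hl
  have hint : AlmostEveryCurve Q μ fun γ => γ.lineIntegral h ≠ ∞ := ⟨h, hh, hit, fun _ _ h => h⟩
  have weak : IsWeakUpperGradient Q μ (fun x => if x ∈ V then h x else g x) f := by
    refine isWeakUpperGradient_of_isGood (f := (f : C(X, Y))) hQ0
      (hh.ite hV.measurableSet hw.1) ((hgood.and hQ0 hint).mono fun γ hγ => ?_)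
    have hr := hγ.1.rectifiable
    refine hγ.1.glue hh hV ?_ fun c d hcd hsub => ?_
    · rw [← hr.lineIntegral_eq hh]
      exact hγ.2
    · rw [← hr.lineIntegral_sub hcd hh]
      refine hup _ (hr.sub hcd) ?_
      rintro _ ⟨t, rfl⟩
      exact hsub t t.2
  have loc : LocIntegrablePow Q μ fun x => if x ∈ V then h x else g x := fun x => by
    obtain ⟨U, hU, hxU, hgU⟩ := hl x
    refine ⟨U, hU, hxU, ?_⟩
    calc ∫⁻ y in U, (if y ∈ V then h y else g y) ^ Q ∂μ
        ≤ ∫⁻ y in U, (h y ^ Q + g y ^ Q) ∂μ := by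
          refine lintegral_mono fun y => ?_
          dsimp only
          split_ifs
          exacts [le_self_add, le_add_self]
      _ = ∫⁻ y in U, h y ^ Q ∂μ + ∫⁻ y in U, g y ^ Q ∂μ := lintegral_add_left (hh.pow_const Q) _
      _ < ∞ := ENNReal.add_lt_top.2 ⟨(setLIntegral_le_lintegral _ _).trans_lt hit, hgU⟩
  refine le_trans ?_ ((setLIntegral_le_lintegral V _).trans hi)
  refine setLIntegral_mono_ae' hV.measurableSet ?_
  filter_upwards [hmin _ weak loc] with x hx hxV
  rw [if_pos hxV] at hx
  exact ENNReal.rpow_le_rpow hx hQ0.le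

/-- If `g dμ` is dominated on open sets by a locally finite measure, then `g` is dominated by
the density of that measure. -/
theorem ae_le_mul_rnDeriv [SecondCountableTopology X] [IsLocallyFiniteMeasure μ]
    {lam : Measure X} [IsLocallyFiniteMeasure lam] {K : ℝ≥0} (hK : 0 < K) {g : X → ℝ≥0∞}
    (hg : Measurable g) (h : ∀ V : Set X, IsOpen V → ∫⁻ x in V, g x ∂μ ≤ K * lam V) :
    ∀ᵐ x ∂μ, g x ≤ K * lam.rnDeriv μ x := by
  have hK0 : (K : ℝ≥0∞) ≠ 0 := ENNReal.coe_ne_zero.2 hK.ne'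
  -- Outer regularity extends the bound from open sets to all sets.
  have all : ∀ s : Set X, ∫⁻ x in s, g x ∂μ ≤ K * lam s := fun s => by
    rw [s.measure_eq_iInf_isOpen lam]
    simp_rw [ENNReal.mul_iInf_of_ne hK0 ENNReal.coe_ne_top]
    exact le_iInf₂ fun V hsV => le_iInf fun hV => (lintegral_mono_set hsV).trans (h V hV)
  -- `T` has full `μ`-measure and carries none of the singular part; intersecting with it leaves
  -- only the density.
  obtain ⟨T, hT, hT1, hT2⟩ := lam.mutuallySingular_singularPart μ
  refine ae_le_of_forall_setLIntegral_le_of_sigmaFinite hg fun s hs _ => ?_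
  have restr : μ.restrict s = μ.restrict (s ∩ T) := by
    refine Measure.restrict_congr_set ?_
    have : T =ᵐ[μ] univ := by rwa [ae_eq_univ]
    simpa using ((ae_eq_refl s).inter this).symm
  calc ∫⁻ x in s, g x ∂μ = ∫⁻ x in s ∩ T, g x ∂μ := by rw [restr]
    _ ≤ K * lam (s ∩ T) := all _
    _ = K * μ.withDensity (lam.rnDeriv μ) (s ∩ T) := by
        conv_lhs => rw [lam.haveLebesgueDecomposition_add μ]
        rw [Measure.add_apply, measure_mono_null inter_subset_right hT1, zero_add]
    _ = K * ∫⁻ x in s, lam.rnDeriv μ x ∂μ := by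
        rw [withDensity_apply _ (hs.inter hT), restr]
    _ = ∫⁻ x in s, K * lam.rnDeriv μ x ∂μ := (lintegral_const_mul' _ _ ENNReal.coe_ne_top).symm

theorem GeometricCondition.analyticCondition [SecondCountableTopology X]
    [IsLocallyFiniteMeasure μ] [IsLocallyFiniteMeasure ν] (hQ : 1 < Q) {K : ℝ≥0} (hK : 0 < K)
    {f : X ≃ₜ Y} (hG : GeometricCondition Q K μ ν f) : AnalyticCondition Q K μ ν f := by
  have hQ0 : 0 < Q := by linarith
  obtain ⟨g₀, hg₀, hl₀⟩ := hG.exists_upperGradient hQ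
  refine ⟨⟨memLpLoc_of_continuous hQ0 f.continuous, g₀, hg₀, hl₀⟩, ?_⟩
  obtain ⟨g, hg⟩ := exists_isMinimalWeakUpperGradient (f := (f : C(X, Y))) hQ0
    (hg₀.isWeakUpperGradient (f := (f : C(X, Y))) (μ := μ) hQ0) hl₀
  refine ⟨g, hg, ?_⟩
  have apply_eq : ∀ V : Set X, IsOpen V → ν.map f.symm V = ν (f '' V) := fun V hV => by
    rw [Measure.map_apply f.symm.continuous.measurable hV.measurableSet, f.image_eq_preimage_symm]
  have : IsLocallyFiniteMeasure (ν.map f.symm) := by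
    refine ⟨fun x => ?_⟩
    obtain ⟨W, hxW, hW, hfin⟩ := ν.exists_isOpen_measure_lt_top (f x)
    have hW' := hW.preimage f.continuous
    refine ⟨f ⁻¹' W, hW'.mem_nhds hxW, ?_⟩
    rwa [apply_eq _ hW', f.image_preimage]
  refine ae_le_mul_rnDeriv hK (hg.1.1.pow_const Q) fun V hV => ?_
  rw [apply_eq V hV]
  by_cases hfin : ν (f '' V) = ∞
  · rw [hfin, ENNReal.mul_top (ENNReal.coe_ne_zero.2 hK.ne')]
    exact le_top
  · exact hG.setLIntegral_minimal_le hQ hg hV hfin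

end Main

end QCMetric

theorem theorem1p1 {X Y : Type*}
    [MetricSpace X] [TopologicalSpace.SeparableSpace X] [MeasurableSpace X] [BorelSpace X]
    [MetricSpace Y] [TopologicalSpace.SeparableSpace Y] [MeasurableSpace Y] [BorelSpace Y]
    (μ : Measure X) [IsLocallyFiniteMeasure μ] [μ.IsOpenPosMeasure]
    (ν : Measure Y) [IsLocallyFiniteMeasure ν] [ν.IsOpenPosMeasure]
    (Q : ℝ) (hQ : 1 < Q) (f : X ≃ₜ Y) (K : ℝ≥0) (hK : 0 < K) :
    QCMetric.AnalyticCondition Q K μ ν f ↔ QCMetric.GeometricCondition Q K μ ν f := by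
  have : SecondCountableTopology X := UniformSpace.secondCountable_of_separable X
  exact ⟨fun h => h.geometricCondition (one_pos.trans hQ) hK,
    fun h => h.analyticCondition hQ hK⟩
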